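/- Let $n,p\ge 1$ be integers, let $a\ge 1$ and $\alpha>1$ be real, and put $\tau=(n+2a+2p)-\alpha(n+2a-2p)$. Write $x=(x',x_{n+1})\in\mathbb R^{n+1}$, let $B_r$ be the open ball of radius $r$ about the origin of $\mathbb R^{n+1}$, and let $$\widetilde\Delta_{n+1,a}=\sum_{j=1}^{n+1}\partial_{x_j}^2+\frac{2a-1}{x_{n+1}}\,\partial_{x_{n+1}},$$ acting on functions that are even in $x_{n+1}$; at points with $x_{n+1}=0$ the quotient $\partial_{x_{n+1}}f/x_{n+1}$ is understood as its limit $\partial_{x_{n+1}}^2f$. Let $u\in C^{2p}(\bar B_1\setminus\{0\})$ be real-valued (with derivatives continuous up to $\partial B_1$), with $u(x',x_{n+1})=u(x',-x_{n+1})$, and with $u\ge 0$ unless $\alpha$ is an integer (so that $u^\alpha$ is defined). Suppose that $$(-\widetilde\Delta_{n+1,a})^p u=|x|^{-\tau}u^\alpha\quad\text{in } B_1\setminus\{0\},\qquad |x_{n+1}|^{2a-1}|x|^{-\tau}u^\alpha\in L^1(B_1).$$ Set $v_i=|x_{n+1}|^{2a-1}(-\widetilde\Delta_{n+1,a})^i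 u$ for $i=0,\dots,p$. Then for every $i=0,\dots,p-1$ the limit below exists and is finite, and $$\int_{\partial B_1}\Bigl[\frac{\partial v_i}{\partial r}-(2a-1)v_i\Bigr]dS+\lim_{s\to0^+}\int_{B_1\setminus B_s}v_{i+1}\,dx=0.$$ Here $\partial v_i/\partial r$ on $\partial B_1$ is the radial derivative from inside the ball, $dS$ is the surface measure of $\partial B_1$, and both integrals converge absolutely for every $s>0$. -/

import Mathlib

open MeasureTheory Metric Filter Topology

noncomputable section

/-- The closed unit ball of `ℝ^(n+1)` without its centre. Derivatives of functions on it are taken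
within this set, so that on the unit sphere they are the continuous extensions from the interior. -/
def puncturedBall (n : ℕ) : Set (EuclideanSpace ℝ (Fin (n + 1))) :=
  closedBall 0 1 \ {0}

/-- The reflection `(x', x_{n+1}) ↦ (x', -x_{n+1})`. -/
def reflectLast {n : ℕ} (x : EuclideanSpace ℝ (Fin (n + 1))) : EuclideanSpace ℝ (Fin (n + 1)) :=
  WithLp.toLp 2 (Function.update x.ofLp (Fin.last n) (-x (Fin.last n)))

/-- The partial derivative `∂f/∂x_j` at `x`, within the set `S`. -/
def partialWithin {n : ℕ} (S : Set (EuclideanSpace ℝ (Fin (n + 1)))) (j : Fin (n + 1))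
    (f : EuclideanSpace ℝ (Fin (n + 1)) → ℝ) (x : EuclideanSpace ℝ (Fin (n + 1))) : ℝ :=
  fderivWithin ℝ f S x (EuclideanSpace.single j 1)

/-- The operator `∑_j ∂_j² f + ((2a-1)/x_{n+1}) ∂_{n+1} f` for functions even in `x_{n+1}`. On the
hyperplane `x_{n+1} = 0`, where `∂_{n+1} f = 0`, the quotient `∂_{n+1} f / x_{n+1}` is given its
limit value `∂_{n+1}² f`. -/
def weightedLaplacian {n : ℕ} (a : ℝ) (S : Set (EuclideanSpace ℝ (Fin (n + 1))))
    (f : EuclideanSpace ℝ (Fin (n + 1)) → ℝ) (x : EuclideanSpace ℝ (Fin (n + 1))) : ℝ :=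
  (∑ j, partialWithin S j (partialWithin S j f) x) +
    (2 * a - 1) *
      (if x (Fin.last n) = 0 then
        partialWithin S (Fin.last n) (partialWithin S (Fin.last n) f) x
      else partialWithin S (Fin.last n) f x / x (Fin.last n))

/-- The iterate `(-Δ̃)^i f` of minus the weighted Laplacian. -/
def negLaplacianPow {n : ℕ} (a : ℝ) (S : Set (EuclideanSpace ℝ (Fin (n + 1)))) :
    ℕ → (EuclideanSpace ℝ (Fin (n + 1)) → ℝ) → EuclideanSpace ℝ (Fin (n + 1)) → ℝ
  | 0, f => f
  | i + 1, f => fun x => -weightedLaplacian a S (negLaplacianPow a S i f) x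

/-- `v_i = |x_{n+1}|^(2a-1) (-Δ̃)^i u` on the closed punctured unit ball. -/
def weightedIterate {n : ℕ} (a : ℝ) (u : EuclideanSpace ℝ (Fin (n + 1)) → ℝ) (i : ℕ)
    (x : EuclideanSpace ℝ (Fin (n + 1))) : ℝ :=
  |x (Fin.last n)| ^ (2 * a - 1) * negLaplacianPow a (puncturedBall n) i u x

/-- The radial derivative `∂f/∂r` at a point `x` of the unit sphere, from inside the ball. -/
def radialDeriv {n : ℕ} (f : EuclideanSpace ℝ (Fin (n + 1)) → ℝ)
    (x : EuclideanSpace ℝ (Fin (n + 1))) : ℝ :=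
  derivWithin (fun r : ℝ => f (r • x)) (Set.Ioc 0 1) 1

end

/-! ### Integrals over `[0,1]` depending on a parameter: continuity and differentiation -/

noncomputable section ParametricIntegral

open Set

variable {E F : Type*} [NormedAddCommGroup E] [NormedAddCommGroup F]

/-! Write `w_i = (-Δ̃)^i u`, `ρ = |x_{n+1}|^(2a-1)`, `N = n+2a-1`, and let `W_i(r)` be the integral
of `ρ(θ) w_i(rθ)` over the unit sphere. Since `ρ Δ̃ f = div(ρ ∇f)` and `ρ` is homogeneous of degree
`2a-1`, these means satisfy `(r^N W_i')' = -r^N W_{i+1}` on `(0,1)` (`hasDerivAt_flux`). Integrating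
from `s` to `1`, the integral of `v_{i+1}` over `B_1 \ B_s` is `s^N W_i'(s) - W_i'(1)`. On the unit
sphere `∂_r v_i - (2a-1) v_i = ρ ∂_r w_i`, so the boundary integral is `W_i'(1)`. The theorem
therefore says that the flux `r^N W_i'` tends to `0` at the origin (`tendsto_flux_zero`).

The flux has a limit, by descending induction on `i`. The function `r^N W_p` is integrable by the
equation and the `L¹` hypothesis, so `r^N W_{p-1}'` converges. A convergent flux gives `W_i' =
O(r^{-N})`, hence `r^N W_i` is bounded near `0`, and the next lower flux converges.

The limit is zero because `u` is not too singular. The value of `τ` makes Young's inequality bound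
`|x|^{-2p}|u|` by `|x|^{-τ}|u|^α` plus a power of `|x|` integrable against `ρ` (`young_rpow`), so
`r^{N-2p} W_0` is integrable. Thus weighted averages of `W_0` over `[ε, 2ε]` are `o(ε^{2p-1-N})`.
Moving the radial operator onto the test function costs `ε^{-2}` per step and gives the analogous
decay for `W_i`; one more integration by parts shows that averages of the flux tend to `0`.

Two points need care. The iterates of the singular operator must stay regular across `x_{n+1} = 0`,
which follows from evenness and Hadamard's formula for the quotient
(`ContDiffOn.lastQuotient_puncturedBall`). The radial equation is derived in weak form, by testing
with radial functions, and then upgraded by a du Bois-Reymond argument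
(`hasDerivAt_of_weak_derivative`). -/

theorem ContinuousOn.intervalIntegral_parametric [NormedSpace ℝ F] {K : Set E} {G : ℝ × E → F}
    (hG : ContinuousOn G (Icc 0 1 ×ˢ K)) :
    ContinuousOn (fun x => ∫ s in (0 : ℝ)..1, G (s, x)) K := by
  rw [continuousOn_iff_continuous_domRestrict]
  -- Projecting `s` onto `[0,1]` extends the integrand continuously to all real `s` without changing
  -- the integral.
  have hc : Continuous (Function.uncurry fun (x : K) (s : ℝ) =>
      G ((projIcc (0 : ℝ) 1 zero_le_one s : ℝ), (x : E))) := by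
    refine hG.comp_continuous (f := fun q : K × ℝ =>
      ((projIcc (0 : ℝ) 1 zero_le_one q.2 : ℝ), (q.1 : E))) ?_ ?_
    · exact (continuous_subtype_val.comp (continuous_projIcc.comp continuous_snd)).prodMk
        (continuous_subtype_val.comp continuous_fst)
    · intro q
      exact ⟨(projIcc (0 : ℝ) 1 zero_le_one q.2).2, q.1.2⟩
  have h := intervalIntegral.continuous_parametric_intervalIntegral_of_continuous'
    (μ := volume) hc 0 1
  refine h.congr fun x => ?_
  refine intervalIntegral.integral_congr fun s hs => ?_
  rw [uIcc_of_le zero_le_one] at hs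
  simp only [projIcc_of_mem zero_le_one hs]

theorem intervalIntegrable_of_continuousOn_prod {K : Set E} {G : ℝ × E → F}
    (hG : ContinuousOn G (Icc 0 1 ×ˢ K)) {x : E} (hx : x ∈ K) :
    IntervalIntegrable (fun s => G (s, x)) volume 0 1 := by
  apply ContinuousOn.intervalIntegrable
  rw [uIcc_of_le zero_le_one]
  exact hG.comp (by fun_prop) fun s hs => ⟨hs, hx⟩

/-- `G'` is uniformly continuous on the compact set `[0,1] × K`, so the mean value inequality on the
convex set `K ∩ ball x₀ δ` gives a remainder `ε ‖x - x₀‖` uniform in `s`, which can be integrated.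
Derivatives within `K` are used so that boundary points of the unit ball are covered. -/
theorem hasFDerivWithinAt_intervalIntegral [NormedSpace ℝ E] [NormedSpace ℝ F]
    [CompleteSpace F] {K : Set E} (hK : IsCompact K)
    (hconv : Convex ℝ K)
    {G : ℝ × E → F} {G' : ℝ × E → E →L[ℝ] F} (hG : ContinuousOn G (Icc 0 1 ×ˢ K))
    (hG' : ContinuousOn G' (Icc 0 1 ×ˢ K))
    (hd : ∀ s ∈ Icc (0 : ℝ) 1, ∀ x ∈ K, HasFDerivWithinAt (fun y => G (s, y)) (G' (s, x)) K x)
    {x₀ : E} (hx₀ : x₀ ∈ K) :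
    HasFDerivWithinAt (fun x => ∫ s in (0 : ℝ)..1, G (s, x)) (∫ s in (0 : ℝ)..1, G' (s, x₀))
      K x₀ := by
  rw [hasFDerivWithinAt_iff_isLittleO, Asymptotics.isLittleO_iff]
  intro ε hε
  have huc := (isCompact_Icc.prod hK).uniformContinuousOn_of_continuous hG'
  rw [Metric.uniformContinuousOn_iff] at huc
  obtain ⟨δ, hδ, hu⟩ := huc ε hε
  filter_upwards [inter_mem_nhdsWithin K (ball_mem_nhds x₀ hδ)] with x hx
  have hpt : ∀ s ∈ Icc (0 : ℝ) 1,
      ‖G (s, x) - G (s, x₀) - G' (s, x₀) (x - x₀)‖ ≤ ε * ‖x - x₀‖ := by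
    intro s hs
    refine Convex.norm_image_sub_le_of_norm_hasFDerivWithin_le' (s := K ∩ ball x₀ δ)
      (f' := fun y => G' (s, y)) (fun y hy => (hd s hs y hy.1).mono inter_subset_left) ?_
      (hconv.inter (convex_ball x₀ δ)) ⟨hx₀, mem_ball_self hδ⟩ hx
    intro y hy
    have h := hu (s, y) ⟨hs, hy.1⟩ (s, x₀) ⟨hs, hx₀⟩ (by
      rw [Prod.dist_eq, dist_self]
      exact max_lt hδ hy.2)
    rw [dist_eq_norm] at h
    exact h.le
  have hi := intervalIntegrable_of_continuousOn_prod hG hx.1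
  have hi₀ := intervalIntegrable_of_continuousOn_prod hG hx₀
  have hi' := intervalIntegrable_of_continuousOn_prod hG' hx₀
  have happ : (∫ s in (0 : ℝ)..1, G' (s, x₀)) (x - x₀) =
      ∫ s in (0 : ℝ)..1, G' (s, x₀) (x - x₀) :=
    ContinuousLinearMap.intervalIntegral_apply hi' _
  have hi'' : IntervalIntegrable (fun s => G' (s, x₀) (x - x₀)) volume 0 1 :=
    intervalIntegrable_of_continuousOn_prod (G := fun q => G' q (x - x₀))
      (hG'.clm_apply continuousOn_const) hx₀
  rw [happ, ← intervalIntegral.integral_sub hi hi₀,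
    ← intervalIntegral.integral_sub (hi.sub hi₀) hi'']
  have := intervalIntegral.norm_integral_le_of_norm_le_const (a := (0 : ℝ)) (b := 1)
    (f := fun s => G (s, x) - G (s, x₀) - G' (s, x₀) (x - x₀)) (C := ε * ‖x - x₀‖)
    (fun s hs => hpt s (by rw [uIoc_of_le zero_le_one] at hs; exact Ioc_subset_Icc_self hs))
  simpa using this

end ParametricIntegral

/-! ### Smooth dependence of parameter integrals -/

noncomputable section ParametricSmooth

open Set

/-- Induction on `k` with `F` generalized, since the derivative takes values in `E →L[ℝ] F`. Both
spaces are in `Type` so that this operator space stays in the same universe. -/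
theorem ContDiffOn.intervalIntegral_parametric {E : Type} [NormedAddCommGroup E]
    [NormedSpace ℝ E] {K : Set E} (hK : IsCompact K)
    (hconv : Convex ℝ K) (hne : (interior K).Nonempty) (k : ℕ) {F : Type} [NormedAddCommGroup F]
    [NormedSpace ℝ F] [CompleteSpace F] {G : ℝ × E → F} (hG : ContDiffOn ℝ k G (Icc 0 1 ×ˢ K)) :
    ContDiffOn ℝ k (fun x => ∫ s in (0 : ℝ)..1, G (s, x)) K := by
  have hUK : UniqueDiffOn ℝ K := uniqueDiffOn_convex hconv hne
  have hU : UniqueDiffOn ℝ (Icc (0 : ℝ) 1 ×ˢ K) := uniqueDiffOn_Icc_zero_one.prod hUK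
  induction k generalizing F with
  | zero =>
    simp only [Nat.cast_zero, contDiffOn_zero] at hG ⊢
    exact hG.intervalIntegral_parametric
  | succ k ih =>
    push_cast at hG ⊢
    rw [contDiffOn_succ_iff_hasFDerivWithinAt_of_uniqueDiffOn hU] at hG
    obtain ⟨-, G', hG', hd⟩ := hG
    rw [contDiffOn_succ_iff_hasFDerivWithinAt_of_uniqueDiffOn hUK]
    refine ⟨by simp, fun x => ∫ s in (0 : ℝ)..1,
      (G' (s, x)).comp (ContinuousLinearMap.inr ℝ ℝ E), ?_, ?_⟩
    · exact ih (F := E →L[ℝ] F)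
        (G := fun q => (G' q).comp (ContinuousLinearMap.inr ℝ ℝ E))
        (hG'.clm_comp contDiffOn_const)
    · intro x hx
      refine hasFDerivWithinAt_intervalIntegral hK hconv
        (fun q hq => (hd q hq).continuousWithinAt)
        (G' := fun q => (G' q).comp (ContinuousLinearMap.inr ℝ ℝ E))
        ((hG'.clm_comp contDiffOn_const).continuousOn) ?_ hx
      intro s hs y hy
      have h := (hd (s, y) ⟨hs, hy⟩).comp y (f := fun z : E => (s, z))
        (hasFDerivAt_prodMk_right s y).hasFDerivWithinAt (t := Icc (0 : ℝ) 1 ×ˢ K) (s := K)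
        (fun z hz => ⟨hs, hz⟩)
      exact h

end ParametricSmooth

/-! ### Parity and regularity of the iterated weighted Laplacian -/

noncomputable section Regularity

open Set

variable {n : ℕ}

theorem uniqueDiffOn_puncturedBall : UniqueDiffOn ℝ (puncturedBall n) := by
  have h : UniqueDiffOn ℝ (closedBall (0 : EuclideanSpace ℝ (Fin (n + 1))) 1) :=
    uniqueDiffOn_convex (convex_closedBall _ _)
      ⟨0, ball_subset_interior_closedBall (mem_ball_self one_pos)⟩
  have := h.inter (isOpen_compl_singleton (x := (0 : EuclideanSpace ℝ (Fin (n + 1)))))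
  rwa [← sdiff_eq] at this

/-- The reflection in the last coordinate as a linear isometry. -/
def reflectLastIsometry (n : ℕ) :
    EuclideanSpace ℝ (Fin (n + 1)) ≃ₗᵢ[ℝ] EuclideanSpace ℝ (Fin (n + 1)) :=
  LinearIsometryEquiv.piLpCongrRight 2 fun j =>
    if j = Fin.last n then LinearIsometryEquiv.neg ℝ else LinearIsometryEquiv.refl ℝ ℝ

theorem reflectLast_apply (x : EuclideanSpace ℝ (Fin (n + 1))) (j : Fin (n + 1)) :
    reflectLast x j = if j = Fin.last n then -x j else x j := by
  by_cases hj : j = Fin.last n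
  · subst hj; simp [reflectLast]
  · simp [reflectLast, hj]

theorem reflectLastIsometry_apply (x : EuclideanSpace ℝ (Fin (n + 1))) :
    reflectLastIsometry n x = reflectLast x := by
  ext j
  rw [reflectLast_apply]
  simp only [reflectLastIsometry, LinearIsometryEquiv.piLpCongrRight_apply]
  split_ifs <;> simp

theorem reflectLast_mem_puncturedBall {x : EuclideanSpace ℝ (Fin (n + 1))} :
    reflectLast x ∈ puncturedBall n ↔ x ∈ puncturedBall n := by
  rw [← reflectLastIsometry_apply]
  simp [puncturedBall]

theorem reflectLast_of_last_eq_zero {x : EuclideanSpace ℝ (Fin (n + 1))} (h : x (Fin.last n) = 0) :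
    reflectLast x = x := by
  ext j
  rw [reflectLast_apply]
  split_ifs with hj
  · rw [hj, h, neg_zero]
  · rfl

theorem reflectLast_single (j : Fin (n + 1)) :
    reflectLast (EuclideanSpace.single j (1 : ℝ)) =
      (if j = Fin.last n then (-1 : ℝ) else 1) • EuclideanSpace.single j (1 : ℝ) := by
  ext k
  rw [reflectLast_apply]
  by_cases hk : k = j
  · subst hk; by_cases h : k = Fin.last n <;> simp [h]
  · have : (EuclideanSpace.single j (1 : ℝ)) k = 0 := by simp [hk]
    rw [PiLp.smul_apply, this]
    simp

/-- Chain rule for the reflection. A general parity factor `c` lets the lemma be applied twice, to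
even functions and then to their derivatives. -/
theorem partialWithin_reflectLast {f : EuclideanSpace ℝ (Fin (n + 1)) → ℝ} {c : ℝ}
    (hf : DifferentiableOn ℝ f (puncturedBall n))
    (hc : ∀ x ∈ puncturedBall n, f (reflectLast x) = c * f x) (j : Fin (n + 1))
    {x : EuclideanSpace ℝ (Fin (n + 1))} (hx : x ∈ puncturedBall n) :
    partialWithin (puncturedBall n) j f (reflectLast x) =
      (if j = Fin.last n then -c else c) * partialWithin (puncturedBall n) j f x := by
  have hpre : (reflectLastIsometry n) ⁻¹' (puncturedBall n) = puncturedBall n := by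
    ext y
    rw [mem_preimage, reflectLastIsometry_apply, reflectLast_mem_puncturedBall]
  have h1 := (reflectLastIsometry n).toContinuousLinearEquiv.comp_right_fderivWithin
    (f := f) (s := puncturedBall n) (x := x) (by
      change UniqueDiffWithinAt ℝ ((reflectLastIsometry n) ⁻¹' (puncturedBall n)) x
      rw [hpre]; exact uniqueDiffOn_puncturedBall x hx)
  have h2 : fderivWithin ℝ (fun y => c * f y) (puncturedBall n) x =
      (fderivWithin ℝ f (puncturedBall n) (reflectLast x)).comp
        ((reflectLastIsometry n).toContinuousLinearEquiv :
          EuclideanSpace ℝ (Fin (n + 1)) →L[ℝ] EuclideanSpace ℝ (Fin (n + 1))) := by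
    rw [← reflectLastIsometry_apply]
    refine Eq.trans ?_ h1
    change _ = fderivWithin ℝ _ ((reflectLastIsometry n) ⁻¹' (puncturedBall n)) x
    rw [hpre]
    refine fderivWithin_congr (fun y hy => ?_) ?_
    · rw [← hc y hy, ← reflectLastIsometry_apply]; rfl
    · rw [← hc x hx, ← reflectLastIsometry_apply]; rfl
  rw [fderivWithin_const_mul (uniqueDiffOn_puncturedBall x hx) (hf x hx)] at h2
  have h3 := congrArg (fun T => T (EuclideanSpace.single j (1 : ℝ))) h2
  simp only [smul_apply, ContinuousLinearMap.comp_apply] at h3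
  change _ = fderivWithin ℝ f (puncturedBall n) (reflectLast x)
    (reflectLastIsometry n (EuclideanSpace.single j 1)) at h3
  rw [reflectLastIsometry_apply, reflectLast_single, map_smul] at h3
  simp only [smul_eq_mul] at h3
  unfold partialWithin
  split_ifs with hj
  · rw [if_pos hj] at h3; linarith
  · rw [if_neg hj] at h3; linarith

theorem ContDiffOn.partialWithin_puncturedBall {k : ℕ} {f : EuclideanSpace ℝ (Fin (n + 1)) → ℝ}
    (hf : ContDiffOn ℝ ((k + 1 : ℕ) : WithTop ℕ∞) f (puncturedBall n)) (j : Fin (n + 1)) :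
    ContDiffOn ℝ k (partialWithin (puncturedBall n) j f) (puncturedBall n) :=
  (hf.fderivWithin uniqueDiffOn_puncturedBall (by norm_cast)).clm_apply contDiffOn_const

/-- Multiplication of the last coordinate by `s`. -/
def scaleLast (s : ℝ) (x : EuclideanSpace ℝ (Fin (n + 1))) : EuclideanSpace ℝ (Fin (n + 1)) :=
  x + ((s - 1) * x (Fin.last n)) • EuclideanSpace.single (Fin.last n) (1 : ℝ)

theorem scaleLast_apply (s : ℝ) (x : EuclideanSpace ℝ (Fin (n + 1))) (j : Fin (n + 1)) :
    scaleLast s x j = if j = Fin.last n then s * x j else x j := by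
  by_cases hj : j = Fin.last n
  · subst hj; simp [scaleLast]; ring
  · simp [scaleLast, hj]

theorem scaleLast_sub (s : ℝ) (x y : EuclideanSpace ℝ (Fin (n + 1))) :
    scaleLast s (x - y) = scaleLast s x - scaleLast s y := by
  ext j
  simp only [scaleLast_apply, PiLp.sub_apply]
  split_ifs <;> ring

theorem scaleLast_of_last_eq_zero (s : ℝ) {x : EuclideanSpace ℝ (Fin (n + 1))}
    (h : x (Fin.last n) = 0) : scaleLast s x = x := by
  simp [scaleLast, h]

theorem scaleLast_one (x : EuclideanSpace ℝ (Fin (n + 1))) : scaleLast 1 x = x := by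
  simp [scaleLast]

theorem norm_scaleLast_le {s : ℝ} (hs : s ∈ Icc (0 : ℝ) 1) (x : EuclideanSpace ℝ (Fin (n + 1))) :
    ‖scaleLast s x‖ ≤ ‖x‖ := by
  rw [EuclideanSpace.norm_eq, EuclideanSpace.norm_eq]
  refine Real.sqrt_le_sqrt (Finset.sum_le_sum fun j _ => ?_)
  rw [scaleLast_apply]
  split_ifs
  · rw [norm_mul, mul_pow]
    have : ‖s‖ ≤ 1 := by rw [Real.norm_eq_abs, abs_of_nonneg hs.1]; exact hs.2
    exact mul_le_of_le_one_left (by positivity) (pow_le_one₀ (norm_nonneg _) this)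
  · exact le_rfl

theorem contDiff_scaleLast {k : WithTop ℕ∞} :
    ContDiff ℝ k fun q : ℝ × EuclideanSpace ℝ (Fin (n + 1)) => scaleLast q.1 q.2 := by
  unfold scaleLast
  fun_prop

theorem hasDerivAt_scaleLast (s : ℝ) (x : EuclideanSpace ℝ (Fin (n + 1))) :
    HasDerivAt (fun t : ℝ => scaleLast t x)
      (x (Fin.last n) • EuclideanSpace.single (Fin.last n) (1 : ℝ)) s := by
  unfold scaleLast
  have := (((hasDerivAt_id s).sub_const 1).mul_const (x (Fin.last n))).smul_const
    (EuclideanSpace.single (Fin.last n) (1 : ℝ))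
  simpa using this.const_add x

/-- The quotient `h / x_{n+1}` of a function odd in `x_{n+1}`, with its limit value at
`x_{n+1} = 0`. -/
def lastQuotient (h : EuclideanSpace ℝ (Fin (n + 1)) → ℝ) (x : EuclideanSpace ℝ (Fin (n + 1))) :
    ℝ :=
  if x (Fin.last n) = 0 then partialWithin (puncturedBall n) (Fin.last n) h x
  else h x / x (Fin.last n)

/-- Hadamard's lemma: an odd `h` vanishes on the hyperplane, so `h(x)/x_{n+1}` is the integral over
`s ∈ [0,1]` of `∂_{n+1} h` at the point with last coordinate `s x_{n+1}`. The integral makes sense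
on the hyperplane too, and only one derivative is lost. -/
theorem ContDiffOn.lastQuotient_puncturedBall {k : ℕ} {h : EuclideanSpace ℝ (Fin (n + 1)) → ℝ}
    (hh : ContDiffOn ℝ ((k + 1 : ℕ) : WithTop ℕ∞) h (puncturedBall n))
    (hodd : ∀ x ∈ puncturedBall n, h (reflectLast x) = -h x) :
    ContDiffOn ℝ k (lastQuotient h) (puncturedBall n) := by
  intro x₀ hx₀
  by_cases h0 : x₀ (Fin.last n) = 0
  · have hpos : 0 < ‖x₀‖ := norm_pos_iff.2 hx₀.2
    have hx₀1 : ‖x₀‖ ≤ 1 := by simpa using hx₀.1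
    -- The radius `‖x₀‖ / 2` keeps `K` away from the origin. As `x₀` lies on the hyperplane it is
    -- fixed by `scaleLast s`, which does not increase norms, so `K` is mapped into itself.
    set K : Set (EuclideanSpace ℝ (Fin (n + 1))) := closedBall x₀ (‖x₀‖ / 2) ∩ closedBall 0 1
      with hK
    have hKS : K ⊆ puncturedBall n := by
      intro x hx
      refine ⟨hx.2, ?_⟩
      rintro rfl
      have := hx.1
      rw [mem_closedBall, dist_zero_left] at this
      linarith
    have hA : ∀ s ∈ Icc (0 : ℝ) 1, ∀ x ∈ K, scaleLast s x ∈ K := by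
      intro s hs x hx
      refine ⟨?_, ?_⟩
      · rw [mem_closedBall, dist_eq_norm]
        nth_rewrite 1 [← scaleLast_of_last_eq_zero s h0]
        rw [← scaleLast_sub]
        refine (norm_scaleLast_le hs _).trans ?_
        rw [← dist_eq_norm]
        exact hx.1
      · rw [mem_closedBall_zero_iff]
        exact (norm_scaleLast_le hs _).trans (by simpa using hx.2)
    have hKc : IsCompact K := (isCompact_closedBall _ _).inter_right isClosed_closedBall
    have hKconv : Convex ℝ K := (convex_closedBall _ _).inter (convex_closedBall _ _)
    have hKint : (interior K).Nonempty := by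
      -- `x₀` may lie on the unit sphere, so an interior point is found by moving towards the
      -- origin.
      refine ⟨(3 / 4 : ℝ) • x₀, ?_⟩
      rw [hK, interior_inter]
      refine ⟨ball_subset_interior_closedBall ?_, ball_subset_interior_closedBall ?_⟩
      · rw [mem_ball, dist_eq_norm]
        have : (3 / 4 : ℝ) • x₀ - x₀ = (-(1 / 4) : ℝ) • x₀ := by module
        rw [this, norm_smul]
        norm_num
        linarith
      · rw [mem_ball_zero_iff, norm_smul]
        norm_num
        linarith
    have hpart := hh.partialWithin_puncturedBall (Fin.last n)
    have hG : ContDiffOn ℝ k (fun q : ℝ × EuclideanSpace ℝ (Fin (n + 1)) =>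
        partialWithin (puncturedBall n) (Fin.last n) h (scaleLast q.1 q.2))
        (Icc (0 : ℝ) 1 ×ˢ K) :=
      hpart.comp contDiff_scaleLast.contDiffOn fun q hq => hKS (hA q.1 hq.1 q.2 hq.2)
    have hQ := ContDiffOn.intervalIntegral_parametric hKc hKconv hKint k hG
    have hnhds : K ∈ 𝓝[puncturedBall n] x₀ := by
      rw [mem_nhdsWithin_iff_exists_mem_nhds_inter]
      exact ⟨closedBall x₀ (‖x₀‖ / 2), closedBall_mem_nhds _ (by positivity),
        fun y hy => ⟨hy.1, hy.2.1⟩⟩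
    have hx₀K : x₀ ∈ K := ⟨mem_closedBall_self (by positivity), hx₀.1⟩
    have heq : ∀ x ∈ K, lastQuotient h x = ∫ s in (0 : ℝ)..1,
        partialWithin (puncturedBall n) (Fin.last n) h (scaleLast s x) := by
      intro x hx
      unfold lastQuotient
      split_ifs with hx0
      · simp [scaleLast_of_last_eq_zero _ hx0]
      · have hcont : ContinuousOn (fun s : ℝ => h (scaleLast s x)) (Icc 0 1) :=
          hh.continuousOn.comp
            (fun s _ => (hasDerivAt_scaleLast s x).continuousAt.continuousWithinAt)
            fun s hs => hKS (hA s hs x hx)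
        have hder : ∀ s ∈ Ioo (0 : ℝ) 1, HasDerivAt (fun s : ℝ => h (scaleLast s x))
            (x (Fin.last n) *
              partialWithin (puncturedBall n) (Fin.last n) h (scaleLast s x)) s := by
          intro s hs
          have hd := ((hh.differentiableOn (by simp)) _
            (hKS (hA s (Ioo_subset_Icc_self hs) x hx))).hasFDerivWithinAt
          have hcomp := hd.comp_hasDerivWithinAt (s := Icc (0 : ℝ) 1) s
            (hasDerivAt_scaleLast s x).hasDerivWithinAt fun t ht => hKS (hA t ht x hx)
          have := hcomp.hasDerivAt (Icc_mem_nhds hs.1 hs.2)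
          rw [map_smul, smul_eq_mul] at this
          exact this
        have hint := intervalIntegrable_of_continuousOn_prod hG.continuousOn hx
        have hft := intervalIntegral.integral_eq_sub_of_hasDerivAt_of_le zero_le_one hcont hder
          (hint.const_mul _)
        rw [intervalIntegral.integral_const_mul, scaleLast_one] at hft
        have hz : h (scaleLast 0 x) = 0 := by
          have hm : scaleLast 0 x ∈ puncturedBall n :=
            hKS (hA 0 ⟨le_rfl, zero_le_one⟩ x hx)
          have := hodd _ hm
          rw [reflectLast_of_last_eq_zero (by simp [scaleLast_apply])] at this
          linarith
        rw [hz, sub_zero] at hft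
        rw [← hft]
        field_simp
    exact ((hQ x₀ hx₀K).congr heq (heq x₀ hx₀K)).mono_of_mem_nhdsWithin hnhds
  · have hev : ∀ᶠ x in 𝓝[puncturedBall n] x₀,
        lastQuotient h x = h x / x (Fin.last n) := by
      have hc : ContinuousAt (fun x : EuclideanSpace ℝ (Fin (n + 1)) => x (Fin.last n)) x₀ := by
        fun_prop
      filter_upwards [nhdsWithin_le_nhds (hc.eventually_ne h0)] with x hx
      exact if_neg hx
    refine ContDiffWithinAt.congr_of_eventuallyEq ?_ hev (if_neg h0)
    refine ((hh.of_le (by norm_cast; omega)) x₀ hx₀).div ?_ h0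
    have : ContDiff ℝ k (fun x : EuclideanSpace ℝ (Fin (n + 1)) => x (Fin.last n)) := by
      fun_prop
    exact this.contDiffWithinAt

theorem weightedLaplacian_eq (a : ℝ) (f : EuclideanSpace ℝ (Fin (n + 1)) → ℝ)
    (x : EuclideanSpace ℝ (Fin (n + 1))) :
    weightedLaplacian a (puncturedBall n) f x =
      (∑ j, partialWithin (puncturedBall n) j (partialWithin (puncturedBall n) j f) x) +
        (2 * a - 1) * lastQuotient (partialWithin (puncturedBall n) (Fin.last n) f) x := rfl

theorem partialWithin_last_odd {f : EuclideanSpace ℝ (Fin (n + 1)) → ℝ}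
    (hf : DifferentiableOn ℝ f (puncturedBall n))
    (heven : ∀ x ∈ puncturedBall n, f (reflectLast x) = f x) :
    ∀ x ∈ puncturedBall n, partialWithin (puncturedBall n) (Fin.last n) f (reflectLast x) =
      -partialWithin (puncturedBall n) (Fin.last n) f x := by
  intro x hx
  have := partialWithin_reflectLast (c := 1) hf (by simpa using heven) (Fin.last n) hx
  simpa using this

theorem ContDiffOn.weightedLaplacian_puncturedBall {k : ℕ} {f : EuclideanSpace ℝ (Fin (n + 1)) → ℝ} (a : ℝ)
    (hf : ContDiffOn ℝ ((k + 2 : ℕ) : WithTop ℕ∞) f (puncturedBall n))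
    (heven : ∀ x ∈ puncturedBall n, f (reflectLast x) = f x) :
    ContDiffOn ℝ k (weightedLaplacian a (puncturedBall n) f) (puncturedBall n) := by
  have h1 : ∀ j, ContDiffOn ℝ ((k + 1 : ℕ) : WithTop ℕ∞)
    (partialWithin (puncturedBall n) j f) (puncturedBall n) := fun j => hf.partialWithin_puncturedBall j
  refine ContDiffOn.congr ?_ fun x _ => weightedLaplacian_eq a f x
  refine (ContDiffOn.sum fun j _ => (h1 j).partialWithin_puncturedBall j).add
    (contDiffOn_const.mul ((h1 _).lastQuotient_puncturedBall ?_))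
  exact partialWithin_last_odd (hf.differentiableOn (by simp)) heven

theorem weightedLaplacian_reflectLast {f : EuclideanSpace ℝ (Fin (n + 1)) → ℝ} (a : ℝ)
    (hf : ContDiffOn ℝ 2 f (puncturedBall n))
    (heven : ∀ x ∈ puncturedBall n, f (reflectLast x) = f x) :
    ∀ x ∈ puncturedBall n, weightedLaplacian a (puncturedBall n) f (reflectLast x) =
      weightedLaplacian a (puncturedBall n) f x := by
  intro x hx
  have hd : DifferentiableOn ℝ f (puncturedBall n) := hf.differentiableOn (by simp)
  have hd1 : ∀ j, DifferentiableOn ℝ (partialWithin (puncturedBall n) j f) (puncturedBall n) :=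
    fun j => (ContDiffOn.partialWithin_puncturedBall (k := 1) (by exact_mod_cast hf) j).differentiableOn
      (by simp)
  have hfirst : ∀ j, ∀ y ∈ puncturedBall n,
      partialWithin (puncturedBall n) j f (reflectLast y) =
        (if j = Fin.last n then -1 else 1) * partialWithin (puncturedBall n) j f y :=
    fun j y hy => partialWithin_reflectLast (c := 1) hd (by simpa using heven) j hy
  have hsecond : ∀ j, partialWithin (puncturedBall n) j (partialWithin (puncturedBall n) j f)
      (reflectLast x) =
      partialWithin (puncturedBall n) j (partialWithin (puncturedBall n) j f) x := by
    intro j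
    rw [partialWithin_reflectLast (hd1 j) (hfirst j) j hx]
    split_ifs <;> simp
  have hlast : reflectLast x (Fin.last n) = -x (Fin.last n) := by simp [reflectLast_apply]
  unfold weightedLaplacian
  simp only [hsecond, hlast, neg_eq_zero, partialWithin_last_odd hd heven x hx, neg_div_neg_eq]

/-- Regularity and evenness are carried together: evenness makes `∂_{n+1}` of an iterate odd, which
is what allows the next division by `x_{n+1}`. Each step costs two derivatives. -/
theorem negLaplacianPow_regular (a : ℝ) {u : EuclideanSpace ℝ (Fin (n + 1)) → ℝ} {p : ℕ}
    (hreg : ContDiffOn ℝ ((2 * p : ℕ) : WithTop ℕ∞) u (puncturedBall n))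
    (heven : ∀ x ∈ puncturedBall n, u (reflectLast x) = u x) {i : ℕ} (hi : i ≤ p) :
    ContDiffOn ℝ ((2 * (p - i) : ℕ) : WithTop ℕ∞) (negLaplacianPow a (puncturedBall n) i u)
        (puncturedBall n) ∧
      ∀ x ∈ puncturedBall n, negLaplacianPow a (puncturedBall n) i u (reflectLast x) =
        negLaplacianPow a (puncturedBall n) i u x := by
  induction i with
  | zero => exact ⟨hreg, heven⟩
  | succ i ih =>
    obtain ⟨h1, h2⟩ := ih (by omega)
    have h3 : 2 * (p - i) = 2 * (p - (i + 1)) + 2 := by omega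
    rw [h3] at h1
    refine ⟨(h1.weightedLaplacian_puncturedBall a h2).neg, fun x hx => ?_⟩
    simp only [negLaplacianPow]
    rw [weightedLaplacian_reflectLast a (h1.of_le (by norm_cast; omega)) h2 x hx]

end Regularity

/-! ### Behaviour at `0` of functions of one variable; test functions on `(1,2)` -/

noncomputable section RadialAsymptotics

open Set

theorem exists_tendsto_of_hasDerivAt_of_integrableAtFilter {g h : ℝ → ℝ}
    (hg : ∀ r ∈ Ioo (0 : ℝ) 1, HasDerivAt g (h r) r) (hh : IntegrableAtFilter h (𝓝[>] 0)) :
    ∃ c, Tendsto g (𝓝[>] 0) (𝓝 c) := by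
  obtain ⟨s, hs, hint⟩ := hh
  obtain ⟨δ, hδ, hsub⟩ := mem_nhdsGT_iff_exists_Ioo_subset.1 hs
  have hδ0 : (0 : ℝ) < δ := hδ
  set d := min (δ / 2) (1 / 2) with hd
  have hd0 : 0 < d := by positivity
  have hdδ : d < δ := (min_le_left _ _).trans_lt (by linarith)
  have hd1 : d < 1 := (min_le_right _ _).trans_lt (by norm_num)
  have hI : IntegrableOn h (Ioc 0 d) :=
    hint.mono_set fun r hr => hsub ⟨hr.1, hr.2.trans_lt hdδ⟩
  have hII : IntervalIntegrable h volume 0 d := (intervalIntegrable_iff_integrableOn_Ioc_of_le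
    hd0.le).2 hI
  have hprim : Tendsto (fun r => ∫ t in (0 : ℝ)..r, h t) (𝓝[>] 0) (𝓝 0) := by
    have hc := intervalIntegral.continuousOn_primitive_interval (μ := volume) (f := h) (a := 0)
      (b := d) (by rw [uIcc_of_le hd0.le, integrableOn_Icc_iff_integrableOn_Ioc]; exact hI)
    have := (hc 0 left_mem_uIcc).tendsto
    rw [intervalIntegral.integral_same, uIcc_of_le hd0.le] at this
    refine this.mono_left (nhdsWithin_le_iff.2 ?_)
    filter_upwards [Ioo_mem_nhdsGT hd0] with x hx using Ioo_subset_Icc_self hx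
  refine ⟨g d - ∫ t in (0 : ℝ)..d, h t + 0, ?_⟩
  have hlim : Tendsto (fun r => g d - (∫ t in (0 : ℝ)..d, h t) + ∫ t in (0 : ℝ)..r, h t)
      (𝓝[>] 0) (𝓝 (g d - (∫ t in (0 : ℝ)..d, h t) + 0)) := hprim.const_add _
  simp only [add_zero] at hlim ⊢
  refine hlim.congr' ?_
  filter_upwards [Ioo_mem_nhdsGT hd0] with r hr
  have hrd : IntervalIntegrable h volume r d := hII.mono_set (by
    rw [uIcc_of_le hr.2.le, uIcc_of_le hd0.le]; exact Icc_subset_Icc_left hr.1.le)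
  have h0r : IntervalIntegrable h volume 0 r := hII.mono_set (by
    rw [uIcc_of_le hr.1.le, uIcc_of_le hd0.le]; exact Icc_subset_Icc_right hr.2.le)
  have hft := intervalIntegral.integral_eq_sub_of_hasDerivAt (f := g) (f' := h) (a := r) (b := d)
    (fun x hx => by
      rw [uIcc_of_le hr.2.le] at hx
      exact hg x ⟨hr.1.trans_le hx.1, hx.2.trans_lt hd1⟩) hrd
  have := intervalIntegral.integral_add_adjacent_intervals h0r hrd
  linarith

/-- A convergent `r^N W'` gives `|W'| ≤ (|c|+1) r^{-N}` on all of `[r,d]`, because `x^N ≥ r^N`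
there. The mean value inequality then bounds `r^N |W(r)|`, and bounded functions are integrable near
`0`. -/
theorem integrableAtFilter_rpow_mul_of_tendsto {N : ℝ} (hN : 0 ≤ N) {W W' : ℝ → ℝ}
    (hW : ∀ r ∈ Ioo (0 : ℝ) 1, HasDerivAt W (W' r) r) {c : ℝ}
    (hc : Tendsto (fun r => r ^ N * W' r) (𝓝[>] 0) (𝓝 c)) :
    IntegrableAtFilter (fun r => r ^ N * W r) (𝓝[>] 0) := by
  have hb : ∀ᶠ r in 𝓝[>] (0 : ℝ), |r ^ N * W' r| < |c| + 1 :=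
    hc.abs.eventually_lt_const (lt_add_one _)
  obtain ⟨δ, hδ, hsub⟩ := mem_nhdsGT_iff_exists_Ioo_subset.1 hb
  have hδ0 : (0 : ℝ) < δ := hδ
  set d := min (δ / 2) (1 / 2) with hd
  have hd0 : 0 < d := by positivity
  have hdδ : d < δ := (min_le_left _ _).trans_lt (by linarith)
  have hd1 : d < 1 := (min_le_right _ _).trans_lt (by norm_num)
  refine ⟨Ioo 0 d, Ioo_mem_nhdsGT hd0, ?_⟩
  have hfin : IsFiniteMeasure ((volume : Measure ℝ).restrict (Ioo 0 d)) :=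
    isFiniteMeasure_restrict.2 (by simp)
  refine Integrable.of_bound ?_ (|W d| + (|c| + 1)) ?_
  · refine ContinuousOn.aestronglyMeasurable (s := Ioo 0 d) ?_ measurableSet_Ioo
    intro r hr
    refine ContinuousWithinAt.mul ?_ (hW r ⟨hr.1, hr.2.trans hd1⟩).continuousAt.continuousWithinAt
    exact (Real.continuousAt_rpow_const _ _ (Or.inl hr.1.ne')).continuousWithinAt
  · refine (ae_restrict_iff' measurableSet_Ioo).2 (ae_of_all _ fun r hr => ?_)
    have hr0 : 0 < r := hr.1
    have hrN : 0 < r ^ N := Real.rpow_pos_of_pos hr0 N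
    have hbd : ∀ x ∈ Icc r d, ‖W' x‖ ≤ (|c| + 1) / r ^ N := by
      intro x hx
      have hx0 : 0 < x := hr0.trans_le hx.1
      have h1 : |x ^ N * W' x| < |c| + 1 := hsub ⟨hx0, hx.2.trans_lt hdδ⟩
      rw [abs_mul, abs_of_pos (Real.rpow_pos_of_pos hx0 N)] at h1
      rw [Real.norm_eq_abs, le_div_iff₀ hrN]
      have h2 : r ^ N ≤ x ^ N := Real.rpow_le_rpow hr0.le hx.1 hN
      nlinarith [abs_nonneg (W' x)]
    have hmv := (convex_Icc r d).norm_image_sub_le_of_norm_hasDerivWithin_le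
      (fun x hx => (hW x ⟨hr0.trans_le hx.1, hx.2.trans_lt hd1⟩).hasDerivWithinAt) hbd
      (right_mem_Icc.2 hr.2.le) (left_mem_Icc.2 hr.2.le)
    rw [Real.norm_eq_abs, Real.norm_eq_abs, abs_sub_comm r d, abs_of_nonneg (show 0 ≤ d - r by linarith [hr.2]),
      div_mul_eq_mul_div, le_div_iff₀ hrN] at hmv
    rw [Real.norm_eq_abs, abs_mul, abs_of_pos hrN]
    have h3 : |W r| ≤ |W d| + |W r - W d| := by
      have := abs_add_le (W d) (W r - W d)
      rwa [add_sub_cancel] at this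
    have h4 : r ^ N ≤ 1 := Real.rpow_le_one hr0.le (hr.2.trans hd1).le hN
    have h5 : (|c| + 1) * (d - r) ≤ |c| + 1 := by
      have : d - r ≤ 1 := by linarith
      nlinarith [abs_nonneg c]
    nlinarith [abs_nonneg (W d), abs_nonneg (W r - W d)]

/-- Smooth functions with compact support in the open interval `(1, 2)`. -/
def IsTestFun (φ : ℝ → ℝ) : Prop :=
  ContDiff ℝ (⊤ : ℕ∞) φ ∧ tsupport φ ⊆ Ioo 1 2

namespace IsTestFun

variable {φ : ℝ → ℝ}

theorem deriv (hφ : IsTestFun φ) : IsTestFun (deriv φ) :=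
  ⟨(contDiff_infty_iff_deriv.1 hφ.1).2, (tsupport_deriv_subset (𝕜 := ℝ)).trans hφ.2⟩

theorem rpow_mul (hφ : IsTestFun φ) (s : ℝ) : IsTestFun fun y => y ^ s * φ y := by
  have hts : tsupport (fun y => y ^ s * φ y) ⊆ tsupport φ := tsupport_mul_subset_right
  refine ⟨contDiff_iff_contDiffAt.2 fun y => ?_, hts.trans hφ.2⟩
  by_cases hy : y ∈ tsupport fun y => y ^ s * φ y
  · have hy' := hφ.2 (hts hy)
    exact (Real.contDiffAt_rpow_const_of_ne (by linarith [hy'.1])).mul hφ.1.contDiffAt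
  · exact contDiffAt_const.congr_of_eventuallyEq (notMem_tsupport_iff_eventuallyEq.1 hy)

theorem hasDerivAt (hφ : IsTestFun φ) (y : ℝ) : HasDerivAt φ (_root_.deriv φ y) y :=
  (hφ.1.differentiable (by simp) y).hasDerivAt

theorem continuous (hφ : IsTestFun φ) : Continuous φ := hφ.1.continuous

theorem apply_one (hφ : IsTestFun φ) : φ 1 = 0 :=
  image_eq_zero_of_notMem_tsupport fun h => (hφ.2 h).1.false

theorem apply_two (hφ : IsTestFun φ) : φ 2 = 0 :=
  image_eq_zero_of_notMem_tsupport fun h => (hφ.2 h).2.false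

theorem exists_bound (hφ : IsTestFun φ) : ∃ M, 0 ≤ M ∧ ∀ y ∈ Icc (1 : ℝ) 2, |φ y| ≤ M := by
  obtain ⟨M, hM⟩ := isCompact_Icc.exists_bound_of_continuousOn (hφ.continuous.continuousOn
    (s := Icc (1 : ℝ) 2))
  exact ⟨M, (norm_nonneg _).trans (hM 1 (by norm_num)), hM⟩

theorem integral_mul_deriv (hφ : IsTestFun φ) {q q' : ℝ → ℝ}
    (hq : ∀ y ∈ Icc (1 : ℝ) 2, HasDerivAt q (q' y) y) (hq' : ContinuousOn q' (Icc 1 2)) :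
    ∫ y in (1 : ℝ)..2, φ y * q' y = -∫ y in (1 : ℝ)..2, _root_.deriv φ y * q y := by
  rw [intervalIntegral.integral_mul_deriv_eq_deriv_mul (u := φ) (u' := _root_.deriv φ) (v := q)
    (fun y _ => hφ.hasDerivAt y) (fun y hy => hq y (by rwa [uIcc_of_le one_le_two] at hy))
    (hφ.deriv.continuous.intervalIntegrable _ _)
    (ContinuousOn.intervalIntegrable (by rwa [uIcc_of_le one_le_two])),
    hφ.apply_one, hφ.apply_two]
  ring

end IsTestFun

theorem exists_isTestFun_nonneg : ∃ χ : ℝ → ℝ, IsTestFun χ ∧ (∀ y, 0 ≤ χ y) ∧ χ (3 / 2) = 1 := by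
  obtain ⟨f, h1, -, h2, h3, h4⟩ := exists_contDiff_tsupport_subset (n := (⊤ : ℕ∞))
    (Ioo_mem_nhds (show (1 : ℝ) < 3 / 2 by norm_num) (show (3 / 2 : ℝ) < 2 by norm_num))
  exact ⟨f, ⟨h2, h1⟩, fun y => (h3 ⟨y, rfl⟩).1, h4⟩

/-- The left side averages `g` over `[ε, 2ε]`, where `g` is uniformly close to `c`. -/
theorem tendsto_integral_testFun_of_tendsto {φ g : ℝ → ℝ} (hφ : IsTestFun φ) {c : ℝ}
    (hg : ContinuousOn g (Ioo 0 1)) (hc : Tendsto g (𝓝[>] 0) (𝓝 c)) :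
    Tendsto (fun ε => ∫ y in (1 : ℝ)..2, φ y * g (ε * y)) (𝓝[>] 0)
      (𝓝 (c * ∫ y in (1 : ℝ)..2, φ y)) := by
  obtain ⟨M, hM0, hM⟩ := hφ.exists_bound
  rw [Metric.tendsto_nhdsWithin_nhds] at hc ⊢
  intro η hη
  obtain ⟨δ, hδ, h⟩ := hc (η / (M + 1)) (by positivity)
  -- Since `y ≤ 2`, this keeps `ε y` below both `δ` and `1`. The `M + 1` above avoids dividing by
  -- zero.
  refine ⟨min (δ / 2) (1 / 2), by positivity, fun {ε} hε hdist => ?_⟩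
  have hε0 : (0 : ℝ) < ε := hε
  rw [dist_zero_right, Real.norm_eq_abs, abs_of_pos hε0, lt_min_iff] at hdist
  have hcont : ContinuousOn (fun y => g (ε * y)) (uIcc 1 2) := by
    rw [uIcc_of_le one_le_two]
    exact hg.comp (by fun_prop) fun y hy => ⟨by nlinarith [hy.1], by nlinarith [hy.1, hy.2]⟩
  have hi : IntervalIntegrable (fun y => φ y * g (ε * y)) volume 1 2 :=
    (hφ.continuous.continuousOn.mul hcont).intervalIntegrable
  have hi' : IntervalIntegrable (fun y => c * φ y) volume 1 2 :=
    (continuous_const.mul hφ.continuous).intervalIntegrable _ _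
  rw [dist_eq_norm, ← intervalIntegral.integral_const_mul, ← intervalIntegral.integral_sub hi hi']
  have hle := intervalIntegral.norm_integral_le_of_norm_le_const (a := (1 : ℝ)) (b := 2)
    (f := fun y => φ y * g (ε * y) - c * φ y) (C := M * (η / (M + 1))) (fun y hy => by
      rw [uIoc_of_le one_le_two] at hy
      have h1 : dist (g (ε * y)) c < η / (M + 1) := h (by
          change 0 < ε * y
          nlinarith [hy.1]) (by
        rw [dist_zero_right, Real.norm_eq_abs, abs_of_pos (by nlinarith [hy.1])]
        nlinarith [hy.1, hy.2])
      rw [mul_comm c, ← mul_sub, norm_mul]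
      rw [dist_eq_norm] at h1
      exact mul_le_mul (hM y (Ioc_subset_Icc_self hy)) h1.le (norm_nonneg _) hM0)
  refine hle.trans_lt ?_
  norm_num
  rw [mul_div_assoc', div_lt_iff₀ (by positivity)]
  nlinarith

theorem tendsto_integral_dyadic_of_integrableOn {F : ℝ → ℝ} (hF : IntegrableOn F (Ioo 0 1)) :
    Tendsto (fun ε => ∫ r in ε..(2 * ε), F r) (𝓝[>] 0) (𝓝 0) := by
  have hI : IntegrableOn F (uIcc 0 1) := by
    rwa [uIcc_of_le zero_le_one, integrableOn_Icc_iff_integrableOn_Ioo]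
  have hII : IntervalIntegrable F volume 0 1 :=
    (intervalIntegrable_iff_integrableOn_Ioo_of_le zero_le_one).2 hF
  have hprim : Tendsto (fun r => ∫ t in (0 : ℝ)..r, F t) (𝓝[>] 0) (𝓝 0) := by
    have hc := intervalIntegral.continuousOn_primitive_interval (μ := volume) hI
    have := (hc 0 left_mem_uIcc).tendsto
    rw [intervalIntegral.integral_same, uIcc_of_le zero_le_one] at this
    refine this.mono_left (nhdsWithin_le_iff.2 ?_)
    filter_upwards [Ioo_mem_nhdsGT one_pos] with x hx using Ioo_subset_Icc_self hx
  have h2 : Tendsto (fun ε : ℝ => 2 * ε) (𝓝[>] 0) (𝓝[>] 0) := by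
    refine tendsto_nhdsWithin_iff.2 ⟨?_, ?_⟩
    · refine Tendsto.mono_left ?_ nhdsWithin_le_nhds
      have : Continuous fun ε : ℝ => 2 * ε := by fun_prop
      simpa using this.tendsto 0
    · filter_upwards [self_mem_nhdsWithin] with x hx
      have hx0 : (0 : ℝ) < x := hx
      exact mem_Ioi.2 (by positivity)
  have := (hprim.comp h2).sub hprim
  rw [sub_zero] at this
  refine this.congr' ?_
  filter_upwards [Ioo_mem_nhdsGT (show (0 : ℝ) < 1 / 2 by norm_num)] with ε hε
  refine intervalIntegral.integral_interval_sub_left ?_ ?_ <;>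
  · refine hII.mono_set ?_
    rw [uIcc_of_le (by linarith [hε.1]), uIcc_of_le zero_le_one]
    exact Icc_subset_Icc_right (by linarith [hε.2])

end RadialAsymptotics

/-! ### Vanishing of the flux at the origin -/

noncomputable section RadialRemovability

open Set

theorem continuousOn_rpow_const_Ioo (s : ℝ) : ContinuousOn (fun r : ℝ => r ^ s) (Ioo 0 1) :=
  fun _ hr => (Real.continuousAt_rpow_const _ _ (Or.inl hr.1.ne')).continuousWithinAt

theorem continuousOn_of_rpow_mul {N : ℝ} {V : ℝ → ℝ}
    (h : ContinuousOn (fun r => r ^ N * V r) (Ioo 0 1)) : ContinuousOn V (Ioo 0 1) := by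
  refine ((continuousOn_rpow_const_Ioo (-N)).mul h).congr fun r hr => ?_
  change V r = r ^ (-N) * (r ^ N * V r)
  rw [← mul_assoc, ← Real.rpow_add hr.1]
  simp

/-- The hypotheses say `V = -r^{-N} (r^N W')'`. Two integrations by parts put the adjoint operator
on the test function, which remains a test function; the two derivatives taken at scale `ε` produce
`ε^{-2}`. -/
theorem integral_testFun_iterate {N : ℝ} {W W' V : ℝ → ℝ}
    (hW : ∀ r ∈ Ioo (0 : ℝ) 1, HasDerivAt W (W' r) r)
    (hflux : ∀ r ∈ Ioo (0 : ℝ) 1, HasDerivAt (fun r => r ^ N * W' r) (-(r ^ N * V r)) r)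
    (hV : ContinuousOn V (Ioo 0 1)) {φ : ℝ → ℝ} (hφ : IsTestFun φ) {ε : ℝ}
    (hε : ε ∈ Ioo (0 : ℝ) (1 / 2)) :
    ∫ y in (1 : ℝ)..2, φ y * V (ε * y) = -(ε ^ (-2 : ℝ) * ∫ y in (1 : ℝ)..2,
      deriv (fun y => y ^ N * deriv (fun y => y ^ (-N) * φ y) y) y * W (ε * y)) := by
  have hε0 : 0 < ε := hε.1
  have hmem : ∀ y ∈ Icc (1 : ℝ) 2, ε * y ∈ Ioo (0 : ℝ) 1 := fun y hy =>
    ⟨by nlinarith [hy.1], by nlinarith [hy.1, hy.2, hε.2]⟩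
  have hθ := hφ.rpow_mul (-N)
  have hθ' := hθ.deriv.rpow_mul N
  have hsc : ∀ y : ℝ, HasDerivAt (fun y : ℝ => ε * y) ε y := fun y => by
    simpa using (hasDerivAt_id y).const_mul ε
  have hcW' : ContinuousOn W' (Ioo 0 1) := continuousOn_of_rpow_mul fun r hr =>
    (hflux r hr).continuousAt.continuousWithinAt
  have h1 := hθ.integral_mul_deriv (q := fun y => (ε * y) ^ N * W' (ε * y))
    (q' := fun y => -((ε * y) ^ N * V (ε * y)) * ε)
    (fun y hy => (hflux _ (hmem y hy)).comp y (hsc y)) (by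
      have : ContinuousOn (fun r => -(r ^ N * V r)) (Ioo 0 1) :=
        ((continuousOn_rpow_const_Ioo N).mul hV).neg
      exact (this.comp (f := fun y => ε * y) (by fun_prop) hmem).mul continuousOn_const)
  have h2 := hθ'.integral_mul_deriv (q := fun y => W (ε * y)) (q' := fun y => W' (ε * y) * ε)
    (fun y hy => (hW _ (hmem y hy)).comp y (hsc y))
    ((hcW'.comp (f := fun y => ε * y) (by fun_prop) hmem).mul continuousOn_const)
  have e1 : ∫ y in (1 : ℝ)..2, y ^ (-N) * φ y * (-((ε * y) ^ N * V (ε * y)) * ε) =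
      -(ε ^ N * ε) * ∫ y in (1 : ℝ)..2, φ y * V (ε * y) := by
    rw [← intervalIntegral.integral_const_mul]
    refine intervalIntegral.integral_congr fun y hy => ?_
    rw [uIcc_of_le one_le_two] at hy
    have hy0 : 0 < y := by linarith [hy.1]
    have hyN : y ^ (-N) * y ^ N = 1 := by rw [← Real.rpow_add hy0]; simp
    simp only [Real.mul_rpow hε0.le hy0.le]
    linear_combination (-(φ y * ε ^ N * V (ε * y) * ε)) * hyN
  have e2 : ∫ y in (1 : ℝ)..2, deriv (fun y => y ^ (-N) * φ y) y * ((ε * y) ^ N * W' (ε * y)) =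
      ε ^ N * ε⁻¹ * ∫ y in (1 : ℝ)..2,
        y ^ N * deriv (fun y => y ^ (-N) * φ y) y * (W' (ε * y) * ε) := by
    rw [← intervalIntegral.integral_const_mul]
    refine intervalIntegral.integral_congr fun y hy => ?_
    rw [uIcc_of_le one_le_two] at hy
    have hy0 : 0 < y := by linarith [hy.1]
    simp only [Real.mul_rpow hε0.le hy0.le]
    field_simp
  rw [e1, e2, h2] at h1
  have hεN : ε ^ N ≠ 0 := (Real.rpow_pos_of_pos hε0 N).ne'
  have hε2 : ε ^ (-2 : ℝ) = ε⁻¹ * ε⁻¹ := by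
    rw [Real.rpow_neg hε0.le]; norm_num; field_simp
  rw [hε2]
  set A := ∫ y in (1 : ℝ)..2, φ y * V (ε * y)
  set B := ∫ y in (1 : ℝ)..2,
    deriv (fun y => y ^ N * deriv (fun y => y ^ (-N) * φ y) y) y * W (ε * y)
  field_simp at h1 ⊢
  linarith

/-- For `i = 0` the substitution `r = ε y` turns the expression into an integral of `r^{N-2p} W_0`
over `[ε, 2ε]` with a bounded weight, which tends to `0` by integrability. Each further `i` costs
`ε^{-2}`, compensated by the term `2i` in the exponent. -/
theorem tendsto_rpow_mul_integral_testFun {N : ℝ} {p : ℕ} {W W' : ℕ → ℝ → ℝ}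
    (hW : ∀ i < p, ∀ r ∈ Ioo (0 : ℝ) 1, HasDerivAt (W i) (W' i r) r)
    (hflux : ∀ i < p, ∀ r ∈ Ioo (0 : ℝ) 1,
      HasDerivAt (fun r => r ^ N * W' i r) (-(r ^ N * W (i + 1) r)) r)
    (hcont : ∀ i ≤ p, ContinuousOn (W i) (Ioo 0 1))
    (hbase : IntegrableOn (fun r => r ^ (N - 2 * p) * W 0 r) (Ioo 0 1)) {i : ℕ} (hi : i ≤ p)
    {φ : ℝ → ℝ} (hφ : IsTestFun φ) :
    Tendsto (fun ε => ε ^ (N + 1 - 2 * p + 2 * i) * ∫ y in (1 : ℝ)..2, φ y * W i (ε * y))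
      (𝓝[>] 0) (𝓝 0) := by
  induction i generalizing φ with
  | zero =>
    -- The factor `y^{-(N-2p)}` compensates the one created in writing `(ε y)^{N-2p}`, so that the
    -- integrand of `hbase` appears at `ε y`.
    obtain ⟨M, hM0, hM⟩ := (hφ.rpow_mul (-(N - 2 * p))).exists_bound
    have hd := (tendsto_integral_dyadic_of_integrableOn hbase.norm).const_mul M
    rw [mul_zero] at hd
    refine squeeze_zero_norm' ?_ hd
    filter_upwards [Ioo_mem_nhdsGT (show (0 : ℝ) < 1 / 2 by norm_num)] with ε hε
    have hε0 : 0 < ε := hε.1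
    have hmem : ∀ y ∈ Icc (1 : ℝ) 2, ε * y ∈ Ioo (0 : ℝ) 1 := fun y hy =>
      ⟨by nlinarith [hy.1], by nlinarith [hy.1, hy.2, hε.2]⟩
    have hsub := intervalIntegral.smul_integral_comp_mul_left (a := 1) (b := 2)
      (fun r => ‖r ^ (N - 2 * p) * W 0 r‖) ε
    rw [mul_one, mul_comm ε 2] at hsub
    rw [← hsub, ← intervalIntegral.integral_const_mul, smul_eq_mul,
      ← intervalIntegral.integral_const_mul, ← intervalIntegral.integral_const_mul]
    refine intervalIntegral.norm_integral_le_of_norm_le one_le_two (ae_of_all _ fun y hy => ?_) ?_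
    · have hy' : y ∈ Icc (1 : ℝ) 2 := Ioc_subset_Icc_self hy
      have hy0 : 0 < y := by linarith [hy'.1]
      have h1 := hM y hy'
      have h2 : ε ^ (N + 1 - 2 * p + 2 * (0 : ℕ)) * (φ y * W 0 (ε * y)) =
          (y ^ (-(N - 2 * p)) * φ y) * (ε * ((ε * y) ^ (N - 2 * p) * W 0 (ε * y))) := by
        have e1 : y ^ (-(N - 2 * (p : ℝ))) * y ^ (N - 2 * (p : ℝ)) = 1 := by
          rw [← Real.rpow_add hy0]; simp
        have e2 : ε ^ (N + 1 - 2 * p + 2 * ((0 : ℕ) : ℝ)) = ε ^ (N - 2 * (p : ℝ)) * ε := by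
          rw [← Real.rpow_add_one hε0.ne']; congr 1; push_cast; ring
        rw [Real.mul_rpow hε0.le hy0.le, e2]
        linear_combination (-(ε ^ (N - 2 * (p : ℝ)) * ε * φ y * W 0 (ε * y))) * e1
      rw [h2, norm_mul, norm_mul ε, Real.norm_of_nonneg hε0.le]
      exact mul_le_mul_of_nonneg_right h1 (by positivity)
    · refine ContinuousOn.intervalIntegrable ?_
      rw [uIcc_of_le one_le_two]
      have : ContinuousOn (fun r => r ^ (N - 2 * (p : ℝ)) * W 0 r) (Ioo 0 1) :=
        (continuousOn_rpow_const_Ioo _).mul (hcont 0 hi)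
      exact continuousOn_const.mul (continuousOn_const.mul
        (this.comp (f := fun y => ε * y) (by fun_prop) hmem).norm)
  | succ i ih =>
    have hφ' := ((hφ.rpow_mul (-N)).deriv.rpow_mul N).deriv
    have h := (ih (by omega) hφ').neg
    rw [neg_zero] at h
    refine h.congr' ?_
    filter_upwards [Ioo_mem_nhdsGT (show (0 : ℝ) < 1 / 2 by norm_num)] with ε hε
    rw [integral_testFun_iterate (hW i hi) (hflux i hi) (hcont (i + 1) hi) hφ hε]
    have e : ε ^ (N + 1 - 2 * p + 2 * ((i + 1 : ℕ) : ℝ)) * ε ^ (-2 : ℝ) =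
        ε ^ (N + 1 - 2 * p + 2 * (i : ℝ)) := by
      rw [← Real.rpow_add hε.1]; congr 1; push_cast; ring
    rw [mul_neg, ← mul_assoc, e]

/-- A limit exists by descending induction from `hint`. Its value is found by testing the flux
against `y^{-N} χ`: the averages tend to `c ∫ y^{-N} χ`, while integration by parts turns them into
averages of `W_i` against `χ'`, which decay. -/
theorem tendsto_flux_zero {N : ℝ} (hN : 0 ≤ N) {p : ℕ} {W W' : ℕ → ℝ → ℝ}
    (hW : ∀ i < p, ∀ r ∈ Ioo (0 : ℝ) 1, HasDerivAt (W i) (W' i r) r)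
    (hflux : ∀ i < p, ∀ r ∈ Ioo (0 : ℝ) 1,
      HasDerivAt (fun r => r ^ N * W' i r) (-(r ^ N * W (i + 1) r)) r)
    (hcont : ∀ i ≤ p, ContinuousOn (W i) (Ioo 0 1))
    (hint : IntegrableOn (fun r => r ^ N * W p r) (Ioo 0 1))
    (hbase : IntegrableOn (fun r => r ^ (N - 2 * p) * W 0 r) (Ioo 0 1)) {i : ℕ} (hi : i < p) :
    Tendsto (fun r => r ^ N * W' i r) (𝓝[>] 0) (𝓝 0) := by
  -- Indexing by `p - 1 - j` makes the descent an ordinary induction on `j`.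
  have hlim : ∀ j, j < p → ∃ c, Tendsto (fun r => r ^ N * W' (p - 1 - j) r) (𝓝[>] 0) (𝓝 c) := by
    intro j hj
    induction j with
    | zero =>
      refine exists_tendsto_of_hasDerivAt_of_integrableAtFilter (hflux (p - 1 - 0) (by omega))
        ⟨Ioo 0 1, Ioo_mem_nhdsGT one_pos, ?_⟩
      have : p - 1 - 0 + 1 = p := by omega
      rw [this]
      exact hint.neg
    | succ j ih =>
      obtain ⟨c, hc⟩ := ih (by omega)
      obtain ⟨s, hs, hI⟩ := integrableAtFilter_rpow_mul_of_tendsto hN (hW (p - 1 - j) (by omega)) hc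
      refine exists_tendsto_of_hasDerivAt_of_integrableAtFilter
        (hflux (p - 1 - (j + 1)) (by omega)) ⟨s, hs, ?_⟩
      have : p - 1 - (j + 1) + 1 = p - 1 - j := by omega
      rw [this]
      exact hI.neg
  obtain ⟨c, hc⟩ := hlim (p - 1 - i) (by omega)
  have hpi : p - 1 - (p - 1 - i) = i := by omega
  rw [hpi] at hc
  obtain ⟨χ, hχ, hχ0, hχ1⟩ := exists_isTestFun_nonneg
  have hgc : ContinuousOn (fun r => r ^ N * W' i r) (Ioo 0 1) := fun r hr =>
    (hflux i hi r hr).continuousAt.continuousWithinAt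
  have hcW' : ContinuousOn (W' i) (Ioo 0 1) := continuousOn_of_rpow_mul hgc
  have hA := tendsto_integral_testFun_of_tendsto (hχ.rpow_mul (-N)) hgc hc
  have hB := tendsto_rpow_mul_integral_testFun hW hflux hcont hbase hi.le hχ.deriv
  -- The surplus power left between the scale `ε^{N-1}` of the flux average and the decay of the
  -- `W_i` average. For `i = p - 1` it is constantly `1`; only convergence is needed, as the other
  -- factor tends to `0`.
  have hpow : Tendsto (fun ε : ℝ => ε ^ (2 * (p - 1 - i) : ℕ)) (𝓝[>] 0)
      (𝓝 (0 ^ (2 * (p - 1 - i) : ℕ))) :=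
    ((continuous_pow _).tendsto 0).mono_left nhdsWithin_le_nhds
  have hC := (hpow.mul hB).neg
  rw [mul_zero, neg_zero] at hC
  have hA0 : Tendsto (fun ε => ∫ y in (1 : ℝ)..2, y ^ (-N) * χ y * ((ε * y) ^ N * W' i (ε * y)))
      (𝓝[>] 0) (𝓝 0) := by
    refine hC.congr' ?_
    filter_upwards [Ioo_mem_nhdsGT (show (0 : ℝ) < 1 / 2 by norm_num)] with ε hε
    have hε0 : 0 < ε := hε.1
    have hmem : ∀ y ∈ Icc (1 : ℝ) 2, ε * y ∈ Ioo (0 : ℝ) 1 := fun y hy =>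
      ⟨by nlinarith [hy.1], by nlinarith [hy.1, hy.2, hε.2]⟩
    have hsc : ∀ y : ℝ, HasDerivAt (fun y : ℝ => ε * y) ε y := fun y => by
      simpa using (hasDerivAt_id y).const_mul ε
    have h2 := hχ.integral_mul_deriv (q := fun y => W i (ε * y)) (q' := fun y => W' i (ε * y) * ε)
      (fun y hy => (hW i hi _ (hmem y hy)).comp y (hsc y))
      ((hcW'.comp (f := fun y => ε * y) (by fun_prop) hmem).mul continuousOn_const)
    have e1 : ∫ y in (1 : ℝ)..2, y ^ (-N) * χ y * ((ε * y) ^ N * W' i (ε * y)) =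
        ε ^ N * ε⁻¹ * ∫ y in (1 : ℝ)..2, χ y * (W' i (ε * y) * ε) := by
      rw [← intervalIntegral.integral_const_mul]
      refine intervalIntegral.integral_congr fun y hy => ?_
      rw [uIcc_of_le one_le_two] at hy
      have hy0 : 0 < y := by linarith [hy.1]
      have hyN : y ^ (-N) * y ^ N = 1 := by rw [← Real.rpow_add hy0]; simp
      have hεε : ε⁻¹ * ε = 1 := inv_mul_cancel₀ hε0.ne'
      simp only [Real.mul_rpow hε0.le hy0.le]
      linear_combination (ε ^ N * χ y * W' i (ε * y)) * hyN -
        (ε ^ N * χ y * W' i (ε * y)) * hεε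
    rw [e1, h2]
    have e2 : ε ^ (2 * (p - 1 - i) : ℕ) * ε ^ (N + 1 - 2 * p + 2 * (i : ℝ)) = ε ^ N * ε⁻¹ := by
      have hsub : ((p - 1 - i : ℕ) : ℝ) = p - 1 - i := by
        rw [Nat.cast_sub (by omega), Nat.cast_sub (by omega)]; simp
      rw [← Real.rpow_natCast, ← Real.rpow_add hε0, ← Real.rpow_neg_one, ← Real.rpow_add hε0]
      congr 1
      push_cast
      rw [hsub]
      ring
    rw [← mul_assoc, e2]
    ring
  have heq := tendsto_nhds_unique hA hA0
  have hpos : 0 < ∫ y in (1 : ℝ)..2, y ^ (-N) * χ y := by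
    have hc' := (hχ.rpow_mul (-N)).continuous
    refine intervalIntegral.integral_pos one_lt_two hc'.continuousOn (fun y hy => ?_)
      ⟨3 / 2, by norm_num, ?_⟩
    · exact mul_nonneg (Real.rpow_nonneg (by linarith [hy.1]) _) (hχ0 y)
    · rw [hχ1, mul_one]
      exact Real.rpow_pos_of_pos (by norm_num) _
  have hc0 : c = 0 := by
    rcases mul_eq_zero.1 heq with h | h
    · exact h
    · exact absurd h hpos.ne'
  rwa [hc0] at hc

end RadialRemovability

/-! ### Polar coordinates and weighted spherical means -/

noncomputable section PolarCoordinates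

open Set

section General

variable {E : Type*} [NormedAddCommGroup E] [NormedSpace ℝ E] [MeasurableSpace E] [BorelSpace E]
  [FiniteDimensional ℝ E] (μ : Measure E) [μ.IsAddHaarMeasure]

theorem integrable_sphere_prod {f : E → ℝ} (hf : Integrable f μ) :
    Integrable (fun q : sphere (0 : E) 1 × Ioi (0 : ℝ) => f ((q.2 : ℝ) • (q.1 : E)))
      (μ.toSphere.prod (Measure.volumeIoiPow (Module.finrank ℝ E - 1))) := by
  rw [← μ.measurePreserving_homeomorphUnitSphereProd.integrable_comp_emb
    (Homeomorph.measurableEmbedding _)]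
  have h : ((fun q : sphere (0 : E) 1 × Ioi (0 : ℝ) => f ((q.2 : ℝ) • (q.1 : E))) ∘
      (homeomorphUnitSphereProd E)) = fun x : ({0}ᶜ : Set E) => f x := by
    ext x
    have hx : ‖(x : E)‖ ≠ 0 := norm_ne_zero_iff.2 x.2
    simp [smul_smul, hx]
  rw [h]
  exact (integrableOn_iff_comap_subtypeVal (measurableSet_singleton _).compl).1 hf.integrableOn

theorem integrableOn_polar {f : E → ℝ} (hf : Integrable f μ) :
    IntegrableOn (fun r : ℝ => r ^ (Module.finrank ℝ E - 1) *
      ∫ θ : sphere (0 : E) 1, f (r • (θ : E)) ∂μ.toSphere) (Ioi 0) := by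
  have h := (integrable_sphere_prod μ hf).integral_prod_right
  rw [integrableOn_iff_comap_subtypeVal measurableSet_Ioi]
  rw [Measure.volumeIoiPow, integrable_withDensity_iff_integrable_smul' (by fun_prop)
    (by simp)] at h
  refine h.congr (ae_of_all _ ?_)
  rintro ⟨x, hx : 0 < x⟩
  simp (disch := positivity) [ENNReal.toReal_ofReal]

/-- Fubini after transport by `homeomorphUnitSphereProd`; `Measure.volumeIoiPow` supplies the factor
`r^(dim - 1)`. Nontriviality makes the omitted origin a null set. -/
theorem integral_polar [Nontrivial E] {f : E → ℝ} (hf : Integrable f μ) :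
    ∫ x, f x ∂μ = ∫ r in Ioi (0 : ℝ), r ^ (Module.finrank ℝ E - 1) *
      ∫ θ : sphere (0 : E) 1, f (r • (θ : E)) ∂μ.toSphere := by
  have h := μ.measurePreserving_homeomorphUnitSphereProd.integral_comp
    (Homeomorph.measurableEmbedding _)
    (fun q : sphere (0 : E) 1 × Ioi (0 : ℝ) => f ((q.2 : ℝ) • (q.1 : E)))
  have hl : ∀ x : ({0}ᶜ : Set E), f (((homeomorphUnitSphereProd E x).2 : ℝ) •
      ((homeomorphUnitSphereProd E x).1 : E)) = f x := by
    intro x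
    have hx : ‖(x : E)‖ ≠ 0 := norm_ne_zero_iff.2 x.2
    simp [smul_smul, hx]
  simp only [hl] at h
  rw [integral_subtype_comap (measurableSet_singleton _).compl f, restrict_compl_singleton,
    integral_prod_symm _ (integrable_sphere_prod μ hf)] at h
  rw [h, Measure.volumeIoiPow, integral_withDensity_eq_integral_toReal_smul (by fun_prop)
    (by simp), ← integral_subtype_comap measurableSet_Ioi fun r : ℝ =>
      r ^ (Module.finrank ℝ E - 1) * ∫ θ : sphere (0 : E) 1, f (r • (θ : E)) ∂μ.toSphere]
  refine integral_congr_ae (ae_of_all _ ?_)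
  rintro ⟨x, hx : 0 < x⟩
  simp (disch := positivity) [ENNReal.toReal_ofReal]

end General

section SphericalMean

variable {n : ℕ}

/-- The integral over the unit sphere, with weight `|x_{n+1}|^(2a-1)`, of `f` on the sphere of
radius `r`. -/
def sphericalMean (a : ℝ) (f : EuclideanSpace ℝ (Fin (n + 1)) → ℝ) (r : ℝ) : ℝ :=
  ∫ θ : sphere (0 : EuclideanSpace ℝ (Fin (n + 1))) 1,
    |(θ : EuclideanSpace ℝ (Fin (n + 1))) (Fin.last n)| ^ (2 * a - 1) *
      f (r • (θ : EuclideanSpace ℝ (Fin (n + 1)))) ∂(volume : Measure _).toSphere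

theorem smul_mem_puncturedBall {r : ℝ} (hr : r ∈ Ioc (0 : ℝ) 1)
    (θ : sphere (0 : EuclideanSpace ℝ (Fin (n + 1))) 1) :
    r • (θ : EuclideanSpace ℝ (Fin (n + 1))) ∈ puncturedBall n := by
  have hθ : ‖(θ : EuclideanSpace ℝ (Fin (n + 1)))‖ = 1 := by simp
  refine ⟨?_, ?_⟩
  · rw [mem_closedBall_zero_iff, norm_smul, hθ, mul_one, Real.norm_of_nonneg hr.1.le]
    exact hr.2
  · intro h
    have := congrArg norm (show r • (θ : EuclideanSpace ℝ (Fin (n + 1))) = 0 from h)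
    rw [norm_smul, hθ, mul_one, norm_zero, norm_eq_zero] at this
    exact hr.1.ne' this

theorem abs_last_rpow_smul {r : ℝ} (hr : 0 ≤ r) (b : ℝ) (x : EuclideanSpace ℝ (Fin (n + 1))) :
    |(r • x) (Fin.last n)| ^ b = r ^ b * |x (Fin.last n)| ^ b := by
  rw [PiLp.smul_apply, smul_eq_mul, abs_mul, abs_of_nonneg hr, Real.mul_rpow hr (abs_nonneg _)]

theorem continuous_abs_last_rpow {b : ℝ} (hb : 0 ≤ b) :
    Continuous fun x : EuclideanSpace ℝ (Fin (n + 1)) => |x (Fin.last n)| ^ b := by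
  refine Continuous.rpow_const (by fun_prop) fun _ => Or.inr hb

/-- The sphere is compact, so joint continuity suffices; it is used on `[r/2, 1]` because `f` may be
singular at the origin. -/
theorem continuousOn_sphericalMean {a : ℝ} (ha : 1 ≤ a)
    {f : EuclideanSpace ℝ (Fin (n + 1)) → ℝ} (hf : ContinuousOn f (puncturedBall n)) :
    ContinuousOn (sphericalMean a f) (Ioc 0 1) := by
  intro r hr
  have hr2 : 0 < r / 2 := half_pos hr.1
  have hc : ContinuousOn (sphericalMean a f) (Icc (r / 2) 1) := by
    rw [continuousOn_iff_continuous_domRestrict]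
    have huc : Continuous (Function.uncurry fun (s : Icc (r / 2) 1)
        (θ : sphere (0 : EuclideanSpace ℝ (Fin (n + 1))) 1) =>
        |(θ : EuclideanSpace ℝ (Fin (n + 1))) (Fin.last n)| ^ (2 * a - 1) *
          f ((s : ℝ) • (θ : EuclideanSpace ℝ (Fin (n + 1))))) := by
      refine Continuous.mul ?_ ?_
      · exact (continuous_abs_last_rpow (by linarith)).comp
          (continuous_subtype_val.comp continuous_snd)
      · refine hf.comp_continuous (f := fun q : Icc (r / 2) 1 ×
          sphere (0 : EuclideanSpace ℝ (Fin (n + 1))) 1 =>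
          (q.1 : ℝ) • (q.2 : EuclideanSpace ℝ (Fin (n + 1)))) (by fun_prop) fun q => ?_
        exact smul_mem_puncturedBall ⟨hr2.trans_le q.1.2.1, q.1.2.2⟩ q.2
    have := continuous_parametric_integral_of_continuous
      (μ := (volume : Measure (EuclideanSpace ℝ (Fin (n + 1)))).toSphere) huc isCompact_univ
    simp only [Measure.restrict_univ] at this
    exact this
  refine (hc r ⟨by linarith [hr.1], hr.2⟩).mono_of_mem_nhdsWithin ?_
  filter_upwards [inter_mem_nhdsWithin (Ioc (0 : ℝ) 1) (Ioi_mem_nhds (show r / 2 < r by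
    linarith [hr.1]))] with x hx using ⟨(show r / 2 < x from hx.2).le, hx.1.2⟩

theorem finrank_euclideanSpace_sub_one :
    Module.finrank ℝ (EuclideanSpace ℝ (Fin (n + 1))) - 1 = n := by simp

/-- Homogeneity of the weight adds `2a - 1` to the Jacobian exponent `n`: radially, the weighted
space behaves as if it had dimension `n + 2a`. -/
theorem radial_weight_polar {a : ℝ} (k : ℝ → ℝ) (f : EuclideanSpace ℝ (Fin (n + 1)) → ℝ)
    {r : ℝ} (hr : 0 < r) :
    r ^ n * ∫ θ : sphere (0 : EuclideanSpace ℝ (Fin (n + 1))) 1,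
      (k ‖r • (θ : EuclideanSpace ℝ (Fin (n + 1)))‖ *
        (|(r • (θ : EuclideanSpace ℝ (Fin (n + 1)))) (Fin.last n)| ^ (2 * a - 1) *
          f (r • (θ : EuclideanSpace ℝ (Fin (n + 1)))))) ∂(volume : Measure _).toSphere =
      k r * (r ^ (n + 2 * a - 1) * sphericalMean a f r) := by
  unfold sphericalMean
  rw [← integral_const_mul, ← integral_const_mul, ← integral_const_mul]
  refine integral_congr_ae (ae_of_all _ fun θ => ?_)
  have hθ : ‖(θ : EuclideanSpace ℝ (Fin (n + 1)))‖ = 1 := by simp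
  have hk : ‖r • (θ : EuclideanSpace ℝ (Fin (n + 1)))‖ = r := by
    rw [norm_smul, hθ, mul_one, Real.norm_of_nonneg hr.le]
  have hp : r ^ ((n : ℝ) + 2 * a - 1) = r ^ n * r ^ (2 * a - 1) := by
    rw [← Real.rpow_natCast, ← Real.rpow_add hr]; congr 1; ring
  simp only [hk, abs_last_rpow_smul hr.le, hp]
  ring

theorem integrableOn_radial_weight {a : ℝ} {k : ℝ → ℝ}
    {f : EuclideanSpace ℝ (Fin (n + 1)) → ℝ}
    (h : Integrable fun x => k ‖x‖ * (|x (Fin.last n)| ^ (2 * a - 1) * f x)) :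
    IntegrableOn (fun r => k r * (r ^ (n + 2 * a - 1) * sphericalMean a f r)) (Ioi 0) := by
  refine (integrableOn_polar volume h).congr_fun (fun r hr => ?_) measurableSet_Ioi
  simp only [finrank_euclideanSpace_sub_one]
  exact radial_weight_polar k f hr

theorem integral_radial_weight {a : ℝ} {k : ℝ → ℝ}
    {f : EuclideanSpace ℝ (Fin (n + 1)) → ℝ}
    (h : Integrable fun x => k ‖x‖ * (|x (Fin.last n)| ^ (2 * a - 1) * f x)) :
    ∫ x, k ‖x‖ * (|x (Fin.last n)| ^ (2 * a - 1) * f x) =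
      ∫ r in Ioi (0 : ℝ), k r * (r ^ (n + 2 * a - 1) * sphericalMean a f r) := by
  rw [integral_polar volume h]
  refine setIntegral_congr_fun measurableSet_Ioi fun r hr => ?_
  simp only [finrank_euclideanSpace_sub_one]
  exact radial_weight_polar k f hr

/-- The closed annulus `s ≤ ‖x‖ ≤ t`. -/
def closedAnnulus (n : ℕ) (s t : ℝ) : Set (EuclideanSpace ℝ (Fin (n + 1))) :=
  {x | s ≤ ‖x‖ ∧ ‖x‖ ≤ t}

theorem isClosed_closedAnnulus (s t : ℝ) : IsClosed (closedAnnulus n s t) :=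
  (isClosed_le continuous_const continuous_norm).inter
    (isClosed_le continuous_norm continuous_const)

theorem isCompact_closedAnnulus (s t : ℝ) : IsCompact (closedAnnulus n s t) :=
  (isCompact_closedBall (0 : EuclideanSpace ℝ (Fin (n + 1))) t).of_isClosed_subset
    (isClosed_closedAnnulus s t) fun _ hx => mem_closedBall_zero_iff.2 hx.2

theorem closedAnnulus_subset_puncturedBall {s t : ℝ} (hs : 0 < s) (ht : t ≤ 1) :
    closedAnnulus n s t ⊆ puncturedBall n := by
  intro x hx
  refine ⟨mem_closedBall_zero_iff.2 (hx.2.trans ht), ?_⟩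
  rintro rfl
  have := hx.1
  rw [norm_zero] at this
  exact absurd this (not_le.2 hs)

theorem integrableOn_weight_annulus {a : ℝ} (ha : 1 ≤ a)
    {f : EuclideanSpace ℝ (Fin (n + 1)) → ℝ} (hf : ContinuousOn f (puncturedBall n)) {s : ℝ}
    (hs : 0 < s) :
    IntegrableOn (fun x => |x (Fin.last n)| ^ (2 * a - 1) * f x) (ball 0 1 \ ball 0 s) := by
  have hc : ContinuousOn (fun x => |x (Fin.last n)| ^ (2 * a - 1) * f x)
      (closedAnnulus n s 1) :=
    (continuous_abs_last_rpow (by linarith)).continuousOn.mul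
      (hf.mono (closedAnnulus_subset_puncturedBall hs le_rfl))
  refine (hc.integrableOn_compact (isCompact_closedAnnulus s 1)).mono_set fun x hx => ?_
  have h1 := hx.1
  have h2 := hx.2
  rw [mem_ball_zero_iff] at h1 h2
  exact ⟨not_lt.1 h2, h1.le⟩

theorem integral_weight_annulus {a : ℝ} (ha : 1 ≤ a)
    {f : EuclideanSpace ℝ (Fin (n + 1)) → ℝ} (hf : ContinuousOn f (puncturedBall n)) {s : ℝ}
    (hs : s ∈ Ioo (0 : ℝ) 1) :
    ∫ x in ball 0 1 \ ball 0 s, |x (Fin.last n)| ^ (2 * a - 1) * f x =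
      ∫ r in s..1, r ^ (n + 2 * a - 1) * sphericalMean a f r := by
  have hm : MeasurableSet (ball (0 : EuclideanSpace ℝ (Fin (n + 1))) 1 \ ball 0 s) :=
    measurableSet_ball.diff measurableSet_ball
  have hI := (integrable_indicator_iff hm).2 (integrableOn_weight_annulus ha hf hs.1)
  -- The indicator of the annulus is a function of `‖x‖`, so it can play the role of `k` in
  -- `integral_radial_weight`.
  have hind : (ball (0 : EuclideanSpace ℝ (Fin (n + 1))) 1 \ ball 0 s).indicator
      (fun x => |x (Fin.last n)| ^ (2 * a - 1) * f x) = fun x =>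
      (Ico s 1).indicator 1 ‖x‖ * (|x (Fin.last n)| ^ (2 * a - 1) * f x) := by
    ext x
    by_cases hx : x ∈ ball (0 : EuclideanSpace ℝ (Fin (n + 1))) 1 \ ball 0 s
    · have hx' : ‖x‖ ∈ Ico s 1 := by
        have h1 := hx.1
        have h2 := hx.2
        rw [mem_ball_zero_iff] at h1 h2
        exact ⟨not_lt.1 h2, h1⟩
      rw [indicator_of_mem hx, indicator_of_mem hx', Pi.one_apply, one_mul]
    · have hx' : ‖x‖ ∉ Ico s 1 := fun h => hx ⟨mem_ball_zero_iff.2 h.2, fun h' =>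
        absurd (mem_ball_zero_iff.1 h') (not_lt.2 h.1)⟩
      rw [indicator_of_notMem hx, indicator_of_notMem hx', zero_mul]
  rw [hind] at hI
  rw [← integral_indicator hm, hind, integral_radial_weight hI,
    intervalIntegral.integral_of_le hs.2.le, ← integral_Ico_eq_integral_Ioc]
  have : ∀ r, (Ico s 1).indicator (1 : ℝ → ℝ) r *
      (r ^ (n + 2 * a - 1) * sphericalMean a f r) =
      (Ico s 1).indicator (fun r => r ^ (n + 2 * a - 1) * sphericalMean a f r) r := by
    intro r
    by_cases hr : r ∈ Ico s 1
    · rw [indicator_of_mem hr, indicator_of_mem hr, Pi.one_apply, one_mul]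
    · rw [indicator_of_notMem hr, indicator_of_notMem hr, zero_mul]
  simp only [this]
  rw [setIntegral_indicator measurableSet_Ico]
  congr 2
  ext r
  exact ⟨fun h => h.2, fun h => ⟨hs.1.trans_le h.1, h⟩⟩

/-- The derivative of `f` in the direction of the radius. -/
def radialField (f : EuclideanSpace ℝ (Fin (n + 1)) → ℝ)
    (x : EuclideanSpace ℝ (Fin (n + 1))) : ℝ :=
  fderivWithin ℝ f (puncturedBall n) x (‖x‖⁻¹ • x)

theorem continuousOn_radialField {f : EuclideanSpace ℝ (Fin (n + 1)) → ℝ}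
    (hf : ContDiffOn ℝ 1 f (puncturedBall n)) :
    ContinuousOn (radialField f) (puncturedBall n) := by
  refine (hf.continuousOn_fderivWithin uniqueDiffOn_puncturedBall le_rfl).clm_apply ?_
  refine ContinuousOn.smul (ContinuousOn.inv₀ continuous_norm.continuousOn fun x hx => ?_)
    continuousOn_id
  exact norm_ne_zero_iff.2 hx.2

theorem radialField_smul (f : EuclideanSpace ℝ (Fin (n + 1)) → ℝ) {r : ℝ} (hr : 0 < r)
    (θ : sphere (0 : EuclideanSpace ℝ (Fin (n + 1))) 1) :
    radialField f (r • (θ : EuclideanSpace ℝ (Fin (n + 1)))) =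
      fderivWithin ℝ f (puncturedBall n) (r • (θ : EuclideanSpace ℝ (Fin (n + 1)))) θ := by
  have hθ : ‖(θ : EuclideanSpace ℝ (Fin (n + 1)))‖ = 1 := by simp
  unfold radialField
  rw [norm_smul, hθ, mul_one, Real.norm_of_nonneg hr.le, smul_smul, inv_mul_cancel₀ hr.ne',
    one_smul]

theorem hasDerivWithinAt_ray {f : EuclideanSpace ℝ (Fin (n + 1)) → ℝ}
    (hf : DifferentiableOn ℝ f (puncturedBall n)) {r : ℝ} (hr : r ∈ Ioc (0 : ℝ) 1)
    (θ : sphere (0 : EuclideanSpace ℝ (Fin (n + 1))) 1) :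
    HasDerivWithinAt (fun s : ℝ => f (s • (θ : EuclideanSpace ℝ (Fin (n + 1)))))
      (radialField f (r • (θ : EuclideanSpace ℝ (Fin (n + 1))))) (Ioc 0 1) r := by
  have h1 : HasDerivWithinAt (fun s : ℝ => s • (θ : EuclideanSpace ℝ (Fin (n + 1))))
      (θ : EuclideanSpace ℝ (Fin (n + 1))) (Ioc 0 1) r := by
    simpa using ((hasDerivAt_id r).smul_const
      (θ : EuclideanSpace ℝ (Fin (n + 1)))).hasDerivWithinAt
  rw [radialField_smul f hr.1]
  exact (hf _ (smul_mem_puncturedBall hr θ)).hasFDerivWithinAt.comp_hasDerivWithinAt r h1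
    fun s hs => smul_mem_puncturedBall hs θ

theorem continuous_sphere_weight_mul {a : ℝ} (ha : 1 ≤ a)
    {f : EuclideanSpace ℝ (Fin (n + 1)) → ℝ} (hf : ContinuousOn f (puncturedBall n)) {r : ℝ}
    (hr : r ∈ Ioc (0 : ℝ) 1) :
    Continuous fun θ : sphere (0 : EuclideanSpace ℝ (Fin (n + 1))) 1 =>
      |(θ : EuclideanSpace ℝ (Fin (n + 1))) (Fin.last n)| ^ (2 * a - 1) *
        f (r • (θ : EuclideanSpace ℝ (Fin (n + 1)))) :=
  ((continuous_abs_last_rpow (by linarith)).comp continuous_subtype_val).mul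
    (hf.comp_continuous (by fun_prop) fun θ => smul_mem_puncturedBall hr θ)

theorem integrable_sphere_of_continuous
    {f : sphere (0 : EuclideanSpace ℝ (Fin (n + 1))) 1 → ℝ} (hf : Continuous f) :
    Integrable f (volume : Measure (EuclideanSpace ℝ (Fin (n + 1)))).toSphere :=
  hf.integrable_of_hasCompactSupport (HasCompactSupport.of_compactSpace f)

theorem hasDerivAt_sphericalMean {a : ℝ} (ha : 1 ≤ a)
    {f : EuclideanSpace ℝ (Fin (n + 1)) → ℝ} (hf : ContDiffOn ℝ 1 f (puncturedBall n)) {r : ℝ}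
    (hr : r ∈ Ioo (0 : ℝ) 1) :
    HasDerivAt (sphericalMean a f) (sphericalMean a (radialField f) r) r := by
  have hr2 : 0 < r / 2 := half_pos hr.1
  have hrad := continuousOn_radialField hf
  -- `C` bounds the integrand with the weight taken at `s • θ`; dividing by `(r / 2) ^ (2 * a - 1)`
  -- converts this to the weight at `θ`, for all `s > r / 2`.
  obtain ⟨C, hC⟩ := (isCompact_closedAnnulus (r / 2) 1).exists_bound_of_continuousOn
    (((continuous_abs_last_rpow (n := n) (show 0 ≤ 2 * a - 1 by linarith)).continuousOn).mul
      (hrad.mono (closedAnnulus_subset_puncturedBall hr2 le_rfl)))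
  have hmem : ∀ s ∈ Ioo (r / 2) 1, s ∈ Ioc (0 : ℝ) 1 := fun s hs => ⟨hr2.trans hs.1, hs.2.le⟩
  refine (hasDerivAt_integral_of_dominated_loc_of_deriv_le
    (F := fun (s : ℝ) (θ : sphere (0 : EuclideanSpace ℝ (Fin (n + 1))) 1) =>
      |(θ : EuclideanSpace ℝ (Fin (n + 1))) (Fin.last n)| ^ (2 * a - 1) *
        f (s • (θ : EuclideanSpace ℝ (Fin (n + 1)))))
    (F' := fun (s : ℝ) (θ : sphere (0 : EuclideanSpace ℝ (Fin (n + 1))) 1) =>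
      |(θ : EuclideanSpace ℝ (Fin (n + 1))) (Fin.last n)| ^ (2 * a - 1) *
        radialField f (s • (θ : EuclideanSpace ℝ (Fin (n + 1)))))
    (bound := fun _ => C / (r / 2) ^ (2 * a - 1))
    (Ioo_mem_nhds (show r / 2 < r by linarith [hr.1]) hr.2) ?_ ?_ ?_ ?_ (integrable_const _)
    ?_).2
  · filter_upwards [Ioo_mem_nhds (show r / 2 < r by linarith [hr.1]) hr.2] with s hs
    exact (continuous_sphere_weight_mul ha hf.continuousOn (hmem s hs)).aestronglyMeasurable
  · exact integrable_sphere_of_continuous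
      (continuous_sphere_weight_mul ha hf.continuousOn ⟨hr.1, hr.2.le⟩)
  · exact (continuous_sphere_weight_mul ha hrad ⟨hr.1, hr.2.le⟩).aestronglyMeasurable
  · refine ae_of_all _ fun θ s hs => ?_
    have hs0 : 0 < s := hr2.trans hs.1
    have hθ : ‖(θ : EuclideanSpace ℝ (Fin (n + 1)))‖ = 1 := by simp
    have hn : ‖s • (θ : EuclideanSpace ℝ (Fin (n + 1)))‖ = s := by
      rw [norm_smul, hθ, mul_one, Real.norm_of_nonneg hs0.le]
    have h := hC (s • (θ : EuclideanSpace ℝ (Fin (n + 1)))) ⟨by rw [hn]; exact hs.1.le,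
      by rw [hn]; exact hs.2.le⟩
    rw [Pi.mul_apply, abs_last_rpow_smul hs0.le, mul_assoc] at h
    have hsp : 0 < s ^ (2 * a - 1) := Real.rpow_pos_of_pos hs0 _
    have hrp : 0 < (r / 2) ^ (2 * a - 1) := Real.rpow_pos_of_pos hr2 _
    have hle : (r / 2) ^ (2 * a - 1) ≤ s ^ (2 * a - 1) :=
      Real.rpow_le_rpow hr2.le hs.1.le (by linarith)
    rw [norm_mul, Real.norm_of_nonneg hsp.le] at h
    rw [le_div_iff₀ hrp, mul_comm]
    exact (mul_le_mul_of_nonneg_right hle (norm_nonneg _)).trans h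
  · refine ae_of_all _ fun θ s hs => ?_
    exact ((hasDerivWithinAt_ray (hf.differentiableOn (by simp)) (hmem s hs) θ).hasDerivAt
      (Ioc_mem_nhds (hmem s hs).1 hs.2)).const_mul _

end SphericalMean

end PolarCoordinates

/-! ### Divergence form of the operator, tested against radial functions -/

noncomputable section WeakForm

open Set

theorem hasDerivAt_abs_rpow_of_ne {y : ℝ} (hy : y ≠ 0) (b : ℝ) :
    HasDerivAt (fun y : ℝ => |y| ^ b) (b * (|y| ^ b / y)) y := by
  have hy' : 0 < |y| := abs_pos.2 hy
  have h := (hasDerivAt_abs hy).rpow_const (p := b) (Or.inl hy'.ne')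
  convert h using 1
  rw [Real.rpow_sub_one hy'.ne']
  rcases lt_or_gt_of_ne hy with h0 | h0
  · rw [abs_of_neg h0, sign_neg h0]
    simp
    field_simp
  · rw [abs_of_pos h0, sign_pos h0]
    simp

/-- Used on the hyperplane, where the weight is only continuous in general (it is `|x_{n+1}|` for `a
= 1`) but multiplies an odd function, which vanishes there. -/
theorem HasDerivAt.continuousAt_mul_of_eq_zero {v q : ℝ → ℝ} {q' x : ℝ} (hv : ContinuousAt v x)
    (hq : HasDerivAt q q' x) (h0 : q x = 0) : HasDerivAt (fun y => v y * q y) (v x * q') x := by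
  rw [hasDerivAt_iff_tendsto_slope] at hq ⊢
  refine ((hv.tendsto.mono_left nhdsWithin_le_nhds).mul hq).congr fun y => ?_
  simp only [slope_def_field, h0]
  ring

variable {n : ℕ}

theorem puncturedBall_mem_nhds {x : EuclideanSpace ℝ (Fin (n + 1))} (h0 : 0 < ‖x‖)
    (h1 : ‖x‖ < 1) : puncturedBall n ∈ 𝓝 x := by
  have h : ball (0 : EuclideanSpace ℝ (Fin (n + 1))) 1 ∩ {0}ᶜ ∈ 𝓝 x :=
    (isOpen_ball.inter isOpen_compl_singleton).mem_nhds
      ⟨mem_ball_zero_iff.2 h1, norm_pos_iff.1 h0⟩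
  exact mem_of_superset h fun y hy => ⟨ball_subset_closedBall hy.1, hy.2⟩

/-- The `j`-th summand of the weighted Laplacian. -/
def weightedLaplacianTerm (a : ℝ) (f : EuclideanSpace ℝ (Fin (n + 1)) → ℝ) (j : Fin (n + 1))
    (x : EuclideanSpace ℝ (Fin (n + 1))) : ℝ :=
  partialWithin (puncturedBall n) j (partialWithin (puncturedBall n) j f) x +
    if j = Fin.last n then
      (2 * a - 1) * lastQuotient (partialWithin (puncturedBall n) (Fin.last n) f) x
    else 0

theorem sum_weightedLaplacianTerm (a : ℝ) (f : EuclideanSpace ℝ (Fin (n + 1)) → ℝ)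
    (x : EuclideanSpace ℝ (Fin (n + 1))) :
    ∑ j, weightedLaplacianTerm a f j x = weightedLaplacian a (puncturedBall n) f x := by
  simp [weightedLaplacianTerm, weightedLaplacian_eq, Finset.sum_add_distrib]

theorem continuousOn_weightedLaplacianTerm (a : ℝ) {f : EuclideanSpace ℝ (Fin (n + 1)) → ℝ}
    (hf : ContDiffOn ℝ 2 f (puncturedBall n))
    (heven : ∀ x ∈ puncturedBall n, f (reflectLast x) = f x) (j : Fin (n + 1)) :
    ContinuousOn (weightedLaplacianTerm a f j) (puncturedBall n) := by
  have h1 : ∀ j, ContDiffOn ℝ ((0 + 1 : ℕ) : WithTop ℕ∞)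
      (partialWithin (puncturedBall n) j f) (puncturedBall n) := fun j =>
    ContDiffOn.partialWithin_puncturedBall (k := 0 + 1) (by exact_mod_cast hf) j
  refine ((h1 j).partialWithin_puncturedBall j).continuousOn.add ?_
  split_ifs
  · exact continuousOn_const.mul ((h1 _).lastQuotient_puncturedBall
      (partialWithin_last_odd (hf.differentiableOn (by simp)) heven)).continuousOn
  · exact continuousOn_const

/-- This is `ρ Δ̃ f = div(ρ ∇f)`, one coordinate at a time. Off the hyperplane, differentiating the
weight in the last direction gives the factor `(2a-1)/x_{n+1}`; on it, the last partial derivative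
and the weight both vanish, so both sides are `0`. -/
theorem hasLineDerivAt_weight_mul_partial {a : ℝ} (ha : 1 ≤ a)
    {f : EuclideanSpace ℝ (Fin (n + 1)) → ℝ} (hf : ContDiffOn ℝ 2 f (puncturedBall n))
    (heven : ∀ x ∈ puncturedBall n, f (reflectLast x) = f x) (j : Fin (n + 1))
    {x : EuclideanSpace ℝ (Fin (n + 1))} (h0 : 0 < ‖x‖) (h1 : ‖x‖ < 1) :
    HasLineDerivAt ℝ
      (fun x => |x (Fin.last n)| ^ (2 * a - 1) * partialWithin (puncturedBall n) j f x)
      (|x (Fin.last n)| ^ (2 * a - 1) * weightedLaplacianTerm a f j x) x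
      (EuclideanSpace.single j (1 : ℝ)) := by
  have hx : puncturedBall n ∈ 𝓝 x := puncturedBall_mem_nhds h0 h1
  have hd : DifferentiableOn ℝ (partialWithin (puncturedBall n) j f) (puncturedBall n) :=
    (ContDiffOn.partialWithin_puncturedBall (k := 1) (by exact_mod_cast hf) j).differentiableOn
      (by simp)
  have hq : HasDerivAt (fun t : ℝ => partialWithin (puncturedBall n) j f
      (x + t • EuclideanSpace.single j (1 : ℝ)))
      (partialWithin (puncturedBall n) j (partialWithin (puncturedBall n) j f) x) 0 :=
    ((hd x (mem_of_mem_nhds hx)).hasFDerivWithinAt.hasFDerivAt hx).hasLineDerivAt _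
  unfold HasLineDerivAt
  by_cases hj : j = Fin.last n
  · subst hj
    have hlast : ∀ t : ℝ, (x + t • EuclideanSpace.single (Fin.last n) (1 : ℝ)) (Fin.last n) =
        x (Fin.last n) + t := fun t => by simp
    simp only [hlast, weightedLaplacianTerm, if_true]
    have hsh : HasDerivAt (fun t : ℝ => x (Fin.last n) + t) 1 0 := by
      simpa using (hasDerivAt_id (0 : ℝ)).const_add (x (Fin.last n))
    by_cases hx0 : x (Fin.last n) = 0
    · have hodd := partialWithin_last_odd (hf.differentiableOn (by simp)) heven x
        (mem_of_mem_nhds hx)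
      rw [reflectLast_of_last_eq_zero hx0] at hodd
      have hz : partialWithin (puncturedBall n) (Fin.last n) f x = 0 := by linarith
      have hv : ContinuousAt (fun t : ℝ => |x (Fin.last n) + t| ^ (2 * a - 1)) 0 := by
        refine ContinuousAt.rpow_const (by fun_prop) (Or.inr (by linarith))
      refine (HasDerivAt.continuousAt_mul_of_eq_zero hv hq (by simpa using hz)).congr_deriv ?_
      simp only [hx0, add_zero, abs_zero, Real.zero_rpow (show 2 * a - 1 ≠ 0 by linarith),
        zero_mul]
    · have hv : HasDerivAt (fun t : ℝ => |x (Fin.last n) + t| ^ (2 * a - 1))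
          ((2 * a - 1) * (|x (Fin.last n)| ^ (2 * a - 1) / x (Fin.last n))) 0 := by
        have h := hasDerivAt_abs_rpow_of_ne hx0 (2 * a - 1)
        have h' : HasDerivAt (fun y : ℝ => |y| ^ (2 * a - 1))
            ((2 * a - 1) * (|x (Fin.last n)| ^ (2 * a - 1) / x (Fin.last n)))
            (x (Fin.last n) + 0) := by rwa [add_zero]
        exact (h'.comp (0 : ℝ) hsh).congr_deriv (mul_one _)
      refine (hv.mul hq).congr_deriv ?_
      simp only [lastQuotient, hx0, if_false, add_zero, zero_smul]
      field_simp
      ring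
  · have hlast : ∀ t : ℝ, (x + t • EuclideanSpace.single j (1 : ℝ)) (Fin.last n) =
        x (Fin.last n) := fun t => by
      have : (EuclideanSpace.single j (1 : ℝ)) (Fin.last n) = 0 := by simp [Ne.symm hj]
      rw [PiLp.add_apply, PiLp.smul_apply, this, smul_zero, add_zero]
    simp only [hlast, weightedLaplacianTerm, if_neg hj, add_zero]
    exact hq.const_mul _

theorem hasDerivAt_norm_line {x : EuclideanSpace ℝ (Fin (n + 1))} (hx : x ≠ 0)
    (j : Fin (n + 1)) :
    HasDerivAt (fun t : ℝ => ‖x + t • EuclideanSpace.single j (1 : ℝ)‖) (x j / ‖x‖) 0 := by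
  have hl : HasDerivAt (fun t : ℝ => x + t • EuclideanSpace.single j (1 : ℝ))
      (EuclideanSpace.single j (1 : ℝ)) 0 := by
    simpa using ((hasDerivAt_id (0 : ℝ)).smul_const
      (EuclideanSpace.single j (1 : ℝ))).const_add x
  have h := hl.norm_sq.sqrt (by simpa using hx)
  simp only [Real.sqrt_sq (norm_nonneg _), zero_smul, add_zero] at h
  convert h using 1
  simp [EuclideanSpace.inner_single_right]
  field_simp

/-- The norm is not differentiable at the origin, but `ψ` vanishes near `0`. -/
theorem hasLineDerivAt_comp_norm {ψ ψ' : ℝ → ℝ} (hψ : ∀ r, HasDerivAt ψ (ψ' r) r) {s : ℝ}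
    (hs : 0 < s) (h0 : ∀ r < s, ψ r = 0) (h0' : ∀ r < s, ψ' r = 0)
    (x : EuclideanSpace ℝ (Fin (n + 1))) (j : Fin (n + 1)) :
    HasLineDerivAt ℝ (fun x => ψ ‖x‖) (ψ' ‖x‖ * (x j / ‖x‖)) x
      (EuclideanSpace.single j (1 : ℝ)) := by
  unfold HasLineDerivAt
  by_cases hx : x = 0
  · subst hx
    rw [norm_zero, h0' 0 hs, zero_mul]
    refine (hasDerivAt_const (0 : ℝ) (0 : ℝ)).congr_of_eventuallyEq ?_
    have hc : ContinuousAt (fun t : ℝ => ‖(0 : EuclideanSpace ℝ (Fin (n + 1))) +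
        t • EuclideanSpace.single j (1 : ℝ)‖) 0 := by fun_prop
    filter_upwards [hc.eventually_lt_const (u := s) (by simpa using hs)] with t ht
    exact h0 _ ht
  · have h : HasDerivAt ψ (ψ' ‖x‖) ‖x + (0 : ℝ) • EuclideanSpace.single j (1 : ℝ)‖ := by
      simpa using hψ ‖x‖
    exact h.comp (0 : ℝ) (hasDerivAt_norm_line hx j)

theorem integrable_comp_norm_mul {k : ℝ → ℝ} (hk : Continuous k) {s t : ℝ} (hs : 0 < s)
    (ht : t ≤ 1) (h0 : ∀ r ∉ Icc s t, k r = 0) {f : EuclideanSpace ℝ (Fin (n + 1)) → ℝ}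
    (hf : ContinuousOn f (puncturedBall n)) : Integrable fun x => k ‖x‖ * f x := by
  have hc : ContinuousOn (fun x => k ‖x‖ * f x) (closedAnnulus n s t) :=
    (hk.comp continuous_norm).continuousOn.mul
      (hf.mono (closedAnnulus_subset_puncturedBall hs ht))
  refine (hc.integrableOn_compact
    (isCompact_closedAnnulus s t)).integrable_of_forall_notMem_eq_zero fun x hx => ?_
  rw [h0 ‖x‖ hx, zero_mul]

/-- Integration by parts in each coordinate direction, then summation. The test function is
supported in a closed annulus inside the open punctured ball, so there are no boundary terms and
line derivatives of `ρ ∂_j f` are needed only there. -/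
theorem weak_radial_equation {a : ℝ} (ha : 1 ≤ a)
    {f : EuclideanSpace ℝ (Fin (n + 1)) → ℝ} (hf : ContDiffOn ℝ 2 f (puncturedBall n))
    (heven : ∀ x ∈ puncturedBall n, f (reflectLast x) = f x) {s t : ℝ} (hs : 0 < s) (ht : t < 1)
    {ψ ψ' : ℝ → ℝ} (hψ : ∀ r, HasDerivAt ψ (ψ' r) r) (hψ' : Continuous ψ')
    (h0 : ∀ r ∉ Icc s t, ψ r = 0) (h0' : ∀ r ∉ Icc s t, ψ' r = 0) :
    ∫ x : EuclideanSpace ℝ (Fin (n + 1)), ψ ‖x‖ * (|x (Fin.last n)| ^ (2 * a - 1) *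
        weightedLaplacian a (puncturedBall n) f x) =
      -∫ x : EuclideanSpace ℝ (Fin (n + 1)),
        ψ' ‖x‖ * (|x (Fin.last n)| ^ (2 * a - 1) * radialField f x) := by
  have hψc : Continuous ψ := continuous_iff_continuousAt.2 fun r => (hψ r).continuousAt
  have hw : ContinuousOn (fun x : EuclideanSpace ℝ (Fin (n + 1)) =>
      |x (Fin.last n)| ^ (2 * a - 1)) (puncturedBall n) :=
    (continuous_abs_last_rpow (by linarith)).continuousOn
  have hpart : ∀ j, ContinuousOn (partialWithin (puncturedBall n) j f) (puncturedBall n) :=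
    fun j => (ContDiffOn.partialWithin_puncturedBall (k := 1) (by exact_mod_cast hf)
      j).continuousOn
  have hterm := continuousOn_weightedLaplacianTerm a hf heven
  have hdir : ∀ j : Fin (n + 1), ContinuousOn
      (fun x : EuclideanSpace ℝ (Fin (n + 1)) => x j / ‖x‖) (puncturedBall n) := fun j =>
    ContinuousOn.div (by fun_prop) continuous_norm.continuousOn
      fun x hx => norm_ne_zero_iff.2 hx.2
  have hI1 : ∀ j, Integrable fun x : EuclideanSpace ℝ (Fin (n + 1)) =>
      ψ ‖x‖ * (|x (Fin.last n)| ^ (2 * a - 1) * weightedLaplacianTerm a f j x) := fun j =>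
    integrable_comp_norm_mul hψc hs ht.le h0 (hw.mul (hterm j))
  have hI2 : ∀ j, Integrable fun x : EuclideanSpace ℝ (Fin (n + 1)) =>
      ψ' ‖x‖ * (x j / ‖x‖ * (|x (Fin.last n)| ^ (2 * a - 1) *
        partialWithin (puncturedBall n) j f x)) := fun j =>
    integrable_comp_norm_mul hψ' hs ht.le h0' ((hdir j).mul (hw.mul (hpart j)))
  have hI3 : ∀ j, Integrable fun x : EuclideanSpace ℝ (Fin (n + 1)) =>
      ψ ‖x‖ * (|x (Fin.last n)| ^ (2 * a - 1) * partialWithin (puncturedBall n) j f x) :=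
    fun j => integrable_comp_norm_mul hψc hs ht.le h0 (hw.mul (hpart j))
  have hsupp : tsupport (fun x : EuclideanSpace ℝ (Fin (n + 1)) => ψ ‖x‖) ⊆
      closedAnnulus n s t := by
    refine closure_minimal (fun x hx => ?_) (isClosed_closedAnnulus s t)
    by_contra hc
    exact hx (h0 ‖x‖ hc)
  have hibp : ∀ j : Fin (n + 1), ∫ x : EuclideanSpace ℝ (Fin (n + 1)),
      ψ ‖x‖ * (|x (Fin.last n)| ^ (2 * a - 1) * weightedLaplacianTerm a f j x) =
      -∫ x : EuclideanSpace ℝ (Fin (n + 1)), ψ' ‖x‖ * (x j / ‖x‖ *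
        (|x (Fin.last n)| ^ (2 * a - 1) * partialWithin (puncturedBall n) j f x)) := by
    intro j
    have := integral_bilinear_hasLineDerivAt_right_eq_neg_left_of_integrable
      (μ := (volume : Measure (EuclideanSpace ℝ (Fin (n + 1)))))
      (f := fun x => ψ ‖x‖) (f' := fun x => ψ' ‖x‖ * (x j / ‖x‖))
      (g := fun x => |x (Fin.last n)| ^ (2 * a - 1) * partialWithin (puncturedBall n) j f x)
      (g' := fun x => |x (Fin.last n)| ^ (2 * a - 1) * weightedLaplacianTerm a f j x)
      (v := EuclideanSpace.single j (1 : ℝ)) (B := ContinuousLinearMap.mul ℝ ℝ)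
      (by simpa only [ContinuousLinearMap.mul_apply', mul_assoc] using hI2 j)
      (by simpa only [ContinuousLinearMap.mul_apply'] using hI1 j)
      (by simpa only [ContinuousLinearMap.mul_apply'] using hI3 j)
      (fun x _ => hasLineDerivAt_comp_norm hψ hs
        (fun r hr => h0 r fun h => absurd h.1 (not_le.2 hr))
        (fun r hr => h0' r fun h => absurd h.1 (not_le.2 hr)) x j)
      (fun x hx => hasLineDerivAt_weight_mul_partial ha hf heven j
        (hs.trans_le (hsupp hx).1) ((hsupp hx).2.trans_lt ht))
    simpa only [ContinuousLinearMap.mul_apply', mul_assoc] using this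
  have hleft : ∀ x : EuclideanSpace ℝ (Fin (n + 1)), ψ ‖x‖ * (|x (Fin.last n)| ^ (2 * a - 1) *
      weightedLaplacian a (puncturedBall n) f x) = ∑ j, ψ ‖x‖ *
      (|x (Fin.last n)| ^ (2 * a - 1) * weightedLaplacianTerm a f j x) := fun x => by
    rw [← sum_weightedLaplacianTerm, Finset.mul_sum, Finset.mul_sum]
  have hright : ∀ x : EuclideanSpace ℝ (Fin (n + 1)), ψ' ‖x‖ *
      (|x (Fin.last n)| ^ (2 * a - 1) * radialField f x) = ∑ j, ψ' ‖x‖ * (x j / ‖x‖ *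
        (|x (Fin.last n)| ^ (2 * a - 1) * partialWithin (puncturedBall n) j f x)) := fun x => by
    have hrf : radialField f x = ∑ j, x j / ‖x‖ * partialWithin (puncturedBall n) j f x := by
      unfold radialField partialWithin
      have hx : ‖x‖⁻¹ • x = ∑ j, (x j / ‖x‖) • EuclideanSpace.single j (1 : ℝ) := by
        ext k
        simp [div_eq_inv_mul, Finset.sum_apply, Pi.single_apply]
      rw [hx, map_sum]
      simp only [map_smul, smul_eq_mul]
    rw [hrf, Finset.mul_sum, Finset.mul_sum]
    exact Finset.sum_congr rfl fun j _ => by ring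
  simp only [hleft, hright]
  rw [integral_finsetSum _ fun j _ => hI1 j, integral_finsetSum _ fun j _ => hI2 j,
    ← Finset.sum_neg_distrib]
  exact Finset.sum_congr rfl fun j _ => hibp j

end WeakForm

/-! ### From the weak to the pointwise radial equation -/

noncomputable section Flux

open Set

/-- Du Bois-Reymond: let `H` be a primitive of `h`. Testing with the primitive `ψ` of `η (g - H -
c)` gives `∫ η (g - H - c)² = 0`, so `g = H + c` near `r`. -/
theorem hasDerivAt_of_weak_derivative {g h : ℝ → ℝ} (hg : ContinuousOn g (Ioo 0 1))
    (hh : ContinuousOn h (Ioo 0 1))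
    (hweak : ∀ s t : ℝ, 0 < s → s < t → t < 1 → ∀ ψ ψ' : ℝ → ℝ, (∀ r, HasDerivAt ψ (ψ' r) r) →
      Continuous ψ' → (∀ r ∉ Icc s t, ψ r = 0) → (∀ r ∉ Icc s t, ψ' r = 0) →
      ∫ r in s..t, ψ r * h r = -∫ r in s..t, ψ' r * g r) {r : ℝ} (hr : r ∈ Ioo (0 : ℝ) 1) :
    HasDerivAt g (h r) r := by
  set s := r / 2 with hs
  set t := (r + 1) / 2 with ht
  have hs0 : 0 < s := half_pos hr.1
  have hsr : s < r := by linarith [hr.1]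
  have hrt : r < t := by linarith [hr.2]
  have ht1 : t < 1 := by linarith [hr.2]
  have hst : s < t := hsr.trans hrt
  have hsub : Icc s t ⊆ Ioo 0 1 := fun x hx => ⟨hs0.trans_le hx.1, hx.2.trans_lt ht1⟩
  -- Constant extension outside `[s,t]` gives globally continuous functions, so that all primitives
  -- below are differentiable everywhere.
  have hext : ∀ k : ℝ → ℝ, ContinuousOn k (Ioo 0 1) →
      ∃ k' : ℝ → ℝ, Continuous k' ∧ ∀ x ∈ Icc s t, k' x = k x := by
    intro k hk
    refine ⟨IccExtend hst.le ((Icc s t).domRestrict k), ?_, fun x hx => ?_⟩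
    · exact Continuous.Icc_extend' (continuousOn_iff_continuous_domRestrict.1 (hk.mono hsub))
    · rw [IccExtend_of_mem hst.le _ hx]; rfl
  obtain ⟨g', hg', hgg'⟩ := hext g hg
  obtain ⟨h', hh', hhh'⟩ := hext h hh
  set H : ℝ → ℝ := fun x => ∫ y in s..x, h' y with hH
  have hHd : ∀ x, HasDerivAt H (h' x) x := fun x =>
    intervalIntegral.integral_hasDerivAt_right (hh'.intervalIntegrable _ _)
      (hh'.stronglyMeasurableAtFilter _ _) hh'.continuousAt
  have hHc : Continuous H := continuous_iff_continuousAt.2 fun x => (hHd x).continuousAt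
  -- A merely continuous bump is enough, since `ψ` only has to be `C¹`.
  set η : ℝ → ℝ := fun x => max 0 ((x - s) * (t - x)) with hη
  have hηc : Continuous η := by fun_prop
  have hη0 : ∀ x, 0 ≤ η x := fun x => le_max_left _ _
  have hηpos : ∀ x ∈ Ioo s t, 0 < η x := fun x hx =>
    lt_max_of_lt_right (mul_pos (by linarith [hx.1]) (by linarith [hx.2]))
  have hηout : ∀ x ∉ Ioo s t, η x = 0 := by
    intro x hx
    refine max_eq_left ?_
    rcases le_or_gt x s with h1 | h1
    · exact mul_nonpos_of_nonpos_of_nonneg (by linarith) (by linarith)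
    · have h2 : t ≤ x := not_lt.1 fun h2 => hx ⟨h1, h2⟩
      exact mul_nonpos_of_nonneg_of_nonpos (by linarith) (by linarith)
  have hηint : 0 < ∫ x in s..t, η x :=
    intervalIntegral.integral_pos hst hηc.continuousOn (fun x _ => hη0 x)
      ⟨r, ⟨hsr.le, hrt.le⟩, hηpos r ⟨hsr, hrt⟩⟩
  -- This value makes `φ` have integral zero, so that its primitive `ψ` vanishes beyond `t`.
  set c := (∫ x in s..t, η x * (g' x - H x)) / ∫ x in s..t, η x with hc
  set φ : ℝ → ℝ := fun x => η x * (g' x - H x - c) with hφ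
  have hφc : Continuous φ := by fun_prop
  have hφout : ∀ x ∉ Ioo s t, φ x = 0 := fun x hx => by simp only [hφ, hηout x hx, zero_mul]
  have hφint : ∫ x in s..t, φ x = 0 := by
    have : ∀ x, φ x = η x * (g' x - H x) - c * η x := fun x => by simp only [hφ]; ring
    simp only [this]
    rw [intervalIntegral.integral_sub
      (Continuous.intervalIntegrable (by fun_prop) _ _)
      (Continuous.intervalIntegrable (by fun_prop) _ _), intervalIntegral.integral_const_mul, hc,
      div_mul_cancel₀ _ hηint.ne', sub_self]
  set ψ : ℝ → ℝ := fun x => ∫ y in s..x, φ y with hψ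
  have hψd : ∀ x, HasDerivAt ψ (φ x) x := fun x =>
    intervalIntegral.integral_hasDerivAt_right (hφc.intervalIntegrable _ _)
      (hφc.stronglyMeasurableAtFilter _ _) hφc.continuousAt
  have hψs : ∀ x ≤ s, ψ x = 0 := by
    intro x hx
    simp only [hψ]
    rw [intervalIntegral.integral_symm, intervalIntegral.integral_congr (g := fun _ => 0)
      fun y hy => ?_]
    · simp
    · rw [uIcc_of_le hx] at hy
      exact hφout y fun h => absurd h.1 (not_lt.2 hy.2)
  have hψt : ∀ x, t ≤ x → ψ x = 0 := by
    intro x hx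
    simp only [hψ]
    rw [← intervalIntegral.integral_add_adjacent_intervals (b := t)
      (hφc.intervalIntegrable _ _) (hφc.intervalIntegrable _ _), hφint,
      intervalIntegral.integral_congr (a := t) (b := x) (g := fun _ => 0) fun y hy => ?_]
    · simp
    · rw [uIcc_of_le hx] at hy
      exact hφout y fun h => absurd h.2 (not_lt.2 hy.1)
  have hw := hweak s t hs0 hst ht1 ψ φ hψd hφc (fun x hx => by
    rcases lt_or_ge x s with h1 | h1
    · exact hψs x h1.le
    · exact hψt x (not_lt.1 fun h2 => hx ⟨h1, h2.le⟩))
    (fun x hx => hφout x fun h => hx (Ioo_subset_Icc_self h))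
  have e1 : ∫ x in s..t, ψ x * h x = ∫ x in s..t, ψ x * h' x :=
    intervalIntegral.integral_congr fun x hx => by
      rw [uIcc_of_le hst.le] at hx
      simp only [hhh' x hx]
  have e2 : ∫ x in s..t, φ x * g x = ∫ x in s..t, φ x * g' x :=
    intervalIntegral.integral_congr fun x hx => by
      rw [uIcc_of_le hst.le] at hx
      simp only [hgg' x hx]
  have e3 := intervalIntegral.integral_mul_deriv_eq_deriv_mul (a := s) (b := t) (u := ψ) (v := H)
    (fun x _ => hψd x) (fun x _ => hHd x) (hφc.intervalIntegrable _ _)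
    (hh'.intervalIntegrable _ _)
  rw [hψs s le_rfl, hψt t le_rfl, zero_mul, zero_mul, sub_zero, zero_sub] at e3
  rw [e1, e2, e3, neg_inj] at hw
  have hsq : ∫ x in s..t, η x * (g' x - H x - c) ^ 2 = 0 := by
    have : ∀ x, η x * (g' x - H x - c) ^ 2 = φ x * g' x - φ x * H x - c * φ x := fun x => by
      simp only [hφ]; ring
    simp only [this]
    rw [intervalIntegral.integral_sub (Continuous.intervalIntegrable (by fun_prop) _ _)
      (Continuous.intervalIntegrable (by fun_prop) _ _), intervalIntegral.integral_sub
      (Continuous.intervalIntegrable (by fun_prop) _ _)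
      (Continuous.intervalIntegrable (by fun_prop) _ _), intervalIntegral.integral_const_mul,
      hφint, hw]
    ring
  have hconst : ∀ x ∈ Ioo s t, g' x - H x - c = 0 := by
    intro x hx
    by_contra hne
    have : 0 < ∫ x in s..t, η x * (g' x - H x - c) ^ 2 :=
      intervalIntegral.integral_pos hst (Continuous.continuousOn (by fun_prop))
        (fun x _ => mul_nonneg (hη0 x) (sq_nonneg _))
        ⟨x, Ioo_subset_Icc_self hx, mul_pos (hηpos x hx) (by positivity)⟩
    exact this.ne' hsq
  have hfin : HasDerivAt (fun x => H x + c) (h' r) r := (hHd r).add_const c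
  rw [hhh' r ⟨hsr.le, hrt.le⟩] at hfin
  refine hfin.congr_of_eventuallyEq ?_
  filter_upwards [Ioo_mem_nhds hsr hrt] with x hx
  rw [← hgg' x (Ioo_subset_Icc_self hx)]
  linarith [hconst x hx]

variable {n : ℕ}

theorem integral_radial_weight_interval {a : ℝ} (ha : 1 ≤ a) {k : ℝ → ℝ} (hk : Continuous k)
    {s t : ℝ} (hs : 0 < s) (hst : s ≤ t) (ht : t ≤ 1) (h0 : ∀ r ∉ Icc s t, k r = 0)
    {f : EuclideanSpace ℝ (Fin (n + 1)) → ℝ} (hf : ContinuousOn f (puncturedBall n)) :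
    ∫ x : EuclideanSpace ℝ (Fin (n + 1)), k ‖x‖ * (|x (Fin.last n)| ^ (2 * a - 1) * f x) =
      ∫ r in s..t, k r * (r ^ (n + 2 * a - 1) * sphericalMean a f r) := by
  rw [integral_radial_weight (integrable_comp_norm_mul hk hs ht h0
    ((continuous_abs_last_rpow (by linarith)).continuousOn.mul hf)),
    intervalIntegral.integral_of_le hst, ← integral_Icc_eq_integral_Ioc]
  refine setIntegral_eq_of_subset_of_forall_sdiff_eq_zero measurableSet_Ioi
    (fun r hr => hs.trans_le hr.1) fun r hr => ?_
  rw [h0 r hr.2, zero_mul]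

theorem continuousOn_flux {a : ℝ} (ha : 1 ≤ a) {f : EuclideanSpace ℝ (Fin (n + 1)) → ℝ}
    (hf : ContinuousOn f (puncturedBall n)) :
    ContinuousOn (fun r : ℝ => r ^ (n + 2 * a - 1) * sphericalMean a f r) (Ioc 0 1) :=
  ContinuousOn.mul (fun _ hr =>
    (Real.continuousAt_rpow_const _ _ (Or.inl hr.1.ne')).continuousWithinAt)
    (continuousOn_sphericalMean ha hf)

/-- In polar coordinates `weak_radial_equation` states that the right side is the weak derivative of
the flux; both are continuous, so it is the classical one. -/
theorem hasDerivAt_flux {a : ℝ} (ha : 1 ≤ a) {f : EuclideanSpace ℝ (Fin (n + 1)) → ℝ}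
    (hf : ContDiffOn ℝ 2 f (puncturedBall n))
    (heven : ∀ x ∈ puncturedBall n, f (reflectLast x) = f x) {r : ℝ} (hr : r ∈ Ioo (0 : ℝ) 1) :
    HasDerivAt (fun r : ℝ => r ^ (n + 2 * a - 1) * sphericalMean a (radialField f) r)
      (r ^ (n + 2 * a - 1) * sphericalMean a (weightedLaplacian a (puncturedBall n) f) r) r := by
  have hrad := continuousOn_radialField (hf.of_le (by norm_cast))
  have hlap : ContinuousOn (weightedLaplacian a (puncturedBall n) f) (puncturedBall n) :=
    (ContDiffOn.weightedLaplacian_puncturedBall (k := 0) a (by exact_mod_cast hf)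
      heven).continuousOn
  refine hasDerivAt_of_weak_derivative
    (h := fun r => r ^ (n + 2 * a - 1) *
      sphericalMean a (weightedLaplacian a (puncturedBall n) f) r)
    ((continuousOn_flux ha hrad).mono Ioo_subset_Ioc_self)
    ((continuousOn_flux ha hlap).mono Ioo_subset_Ioc_self) ?_ hr
  intro s t hs hst ht ψ ψ' hψ hψ' h0 h0'
  have hψc : Continuous ψ := continuous_iff_continuousAt.2 fun r => (hψ r).continuousAt
  rw [← integral_radial_weight_interval ha hψc hs hst.le ht.le h0 hlap,
    ← integral_radial_weight_interval ha hψ' hs hst.le ht.le h0' hrad]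
  exact weak_radial_equation ha hf heven hs ht hψ hψ' h0 h0'

end Flux

/-! ### Integrability of `|x|^{-2p} u` near the origin, and the boundary derivative -/

noncomputable section Singularity

open Set

/-- Either the left side is at most the last term, or `y > R^{2P - D + 2P/(α-1)}`. In the second
case, raising to the power `α - 1` gives exactly `R^{-2P} ≤ R^{-τ} y^{α-1}` with `τ = (D + 2P) - α(D
- 2P)`. -/
theorem young_rpow {R y D α P : ℝ} (hR : 0 < R) (hy : 0 ≤ y) (hα : 1 < α) :
    R ^ (-(2 * P)) * y ≤
      R ^ (-((D + 2 * P) - α * (D - 2 * P))) * y ^ α + R ^ (-D + 2 * P / (α - 1)) := by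
  have hα1 : 0 < α - 1 := by linarith
  rcases le_or_gt (R ^ (-(2 * P)) * y) (R ^ (-D + 2 * P / (α - 1))) with h | h
  · have : 0 ≤ R ^ (-((D + 2 * P) - α * (D - 2 * P))) * y ^ α := by positivity
    linarith
  · have hRP : R ^ (2 * P) * R ^ (-(2 * P)) = 1 := by rw [← Real.rpow_add hR]; simp
    have h1 : R ^ (2 * P + (-D + 2 * P / (α - 1))) < y := by
      rw [Real.rpow_add hR]
      calc R ^ (2 * P) * R ^ (-D + 2 * P / (α - 1)) < R ^ (2 * P) * (R ^ (-(2 * P)) * y) :=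
            mul_lt_mul_of_pos_left h (Real.rpow_pos_of_pos hR _)
        _ = y := by rw [← mul_assoc, hRP, one_mul]
    have hy0 : 0 < y := (Real.rpow_pos_of_pos hR _).trans h1
    have h2 : R ^ ((2 * P + (-D + 2 * P / (α - 1))) * (α - 1)) ≤ y ^ (α - 1) := by
      rw [Real.rpow_mul hR.le]
      exact Real.rpow_le_rpow (Real.rpow_nonneg hR.le _) h1.le hα1.le
    have h3 : y ^ α = y ^ (α - 1) * y := by rw [← Real.rpow_add_one hy0.ne']; simp
    have h4 : R ^ (-(2 * P)) = R ^ (-((D + 2 * P) - α * (D - 2 * P))) *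
        R ^ ((2 * P + (-D + 2 * P / (α - 1))) * (α - 1)) := by
      rw [← Real.rpow_add hR]
      congr 1
      field_simp
      ring
    have h5 : R ^ (-(2 * P)) * y ≤ R ^ (-((D + 2 * P) - α * (D - 2 * P))) * y ^ α := by
      rw [h4, h3, ← mul_assoc]
      gcongr
    have : 0 ≤ R ^ (-D + 2 * P / (α - 1)) := Real.rpow_nonneg hR.le _
    linarith

theorem abs_rpow_eq_rpow_abs {y α : ℝ} (h : (∃ m : ℕ, α = m) ∨ 0 ≤ y) :
    |y ^ α| = |y| ^ α := by
  rcases h with ⟨m, rfl⟩ | h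
  · rw [Real.rpow_natCast, Real.rpow_natCast, abs_pow]
  · rw [abs_of_nonneg (Real.rpow_nonneg h _), abs_of_nonneg h]

variable {n : ℕ}

/-- Bounding `|x_{n+1}|` by `‖x‖` reduces this to `r^{n + 2a - 1 + e}` on `(0,1)`, integrable when
the exponent exceeds `-1`. -/
theorem integrableOn_weight_mul_norm_rpow {a e : ℝ} (ha : 1 ≤ a) (he : -(n + 2 * a) < e) :
    IntegrableOn (fun x : EuclideanSpace ℝ (Fin (n + 1)) =>
      |x (Fin.last n)| ^ (2 * a - 1) * ‖x‖ ^ e) (ball 0 1 \ {0}) := by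
  have hI : IntegrableOn (fun x : EuclideanSpace ℝ (Fin (n + 1)) => ‖x‖ ^ (2 * a - 1 + e))
      (ball 0 1) := by
    refine (integrableOn_fun_norm_addHaar volume (f := fun r : ℝ => r ^ (2 * a - 1 + e))).2 ?_
    have h := (intervalIntegral.integrableOn_Ioo_rpow_iff (s := n + (2 * a - 1 + e))
      one_pos).2 (by linarith)
    refine h.congr_fun (fun r hr => ?_) measurableSet_Ioo
    simp only [finrank_euclideanSpace_sub_one, smul_eq_mul]
    rw [Real.rpow_add hr.1, Real.rpow_natCast]
  refine (hI.mono_set sdiff_subset).mono' ?_ ?_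
  · refine ContinuousOn.aestronglyMeasurable
      (s := ball (0 : EuclideanSpace ℝ (Fin (n + 1))) 1 \ {0}) ?_
      (measurableSet_ball.diff (measurableSet_singleton _))
    refine (continuous_abs_last_rpow (by linarith)).continuousOn.mul
      (ContinuousOn.rpow_const continuous_norm.continuousOn fun x hx => Or.inl ?_)
    exact norm_ne_zero_iff.2 hx.2
  · refine (ae_restrict_iff' (measurableSet_ball.diff (measurableSet_singleton _))).2
      (ae_of_all _ fun x hx => ?_)
    have hx0 : 0 < ‖x‖ := norm_pos_iff.2 hx.2
    rw [Real.norm_of_nonneg (by positivity), Real.rpow_add hx0]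
    have hle : |x (Fin.last n)| ≤ ‖x‖ := by simpa using PiLp.norm_apply_le x (Fin.last n)
    exact mul_le_mul_of_nonneg_right
      (Real.rpow_le_rpow (abs_nonneg _) hle (by linarith)) (by positivity)

theorem integrableOn_flux_of_integrableOn_weight {a : ℝ}
    {f : EuclideanSpace ℝ (Fin (n + 1)) → ℝ}
    (h : IntegrableOn (fun x => |x (Fin.last n)| ^ (2 * a - 1) * f x) (ball 0 1 \ {0})) :
    IntegrableOn (fun r : ℝ => r ^ (n + 2 * a - 1) * sphericalMean a f r) (Ioo 0 1) := by
  have hm : MeasurableSet (ball (0 : EuclideanSpace ℝ (Fin (n + 1))) 1 \ {0}) :=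
    measurableSet_ball.diff (measurableSet_singleton _)
  have hI := (integrable_indicator_iff hm).2 h
  have hind : (ball (0 : EuclideanSpace ℝ (Fin (n + 1))) 1 \ {0}).indicator
      (fun x => |x (Fin.last n)| ^ (2 * a - 1) * f x) = fun x =>
      (Ioo 0 1).indicator 1 ‖x‖ * (|x (Fin.last n)| ^ (2 * a - 1) * f x) := by
    ext x
    by_cases hx : x ∈ ball (0 : EuclideanSpace ℝ (Fin (n + 1))) 1 \ {0}
    · have hx' : ‖x‖ ∈ Ioo (0 : ℝ) 1 := ⟨norm_pos_iff.2 hx.2, mem_ball_zero_iff.1 hx.1⟩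
      rw [indicator_of_mem hx, indicator_of_mem hx', Pi.one_apply, one_mul]
    · have hx' : ‖x‖ ∉ Ioo (0 : ℝ) 1 := fun h =>
        hx ⟨mem_ball_zero_iff.2 h.2, norm_pos_iff.1 h.1⟩
      rw [indicator_of_notMem hx, indicator_of_notMem hx', zero_mul]
  rw [hind] at hI
  refine ((integrableOn_radial_weight hI).mono_set Ioo_subset_Ioi_self).congr_fun
    (fun r hr => ?_) measurableSet_Ioo
  simp only [indicator_of_mem hr, Pi.one_apply, one_mul]

theorem sphericalMean_norm_rpow_mul (a e : ℝ) (f : EuclideanSpace ℝ (Fin (n + 1)) → ℝ) {r : ℝ}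
    (hr : 0 < r) :
    sphericalMean a (fun x => ‖x‖ ^ e * f x) r = r ^ e * sphericalMean a f r := by
  unfold sphericalMean
  rw [← integral_const_mul]
  refine integral_congr_ae (ae_of_all _ fun θ => ?_)
  have hθ : ‖(θ : EuclideanSpace ℝ (Fin (n + 1)))‖ = 1 := by simp
  simp only [norm_smul, hθ, mul_one, Real.norm_of_nonneg hr.le]
  ring

theorem sphericalMean_neg (a : ℝ) (f : EuclideanSpace ℝ (Fin (n + 1)) → ℝ) (r : ℝ) :
    sphericalMean a (fun x => -f x) r = -sphericalMean a f r := by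
  unfold sphericalMean
  rw [← integral_neg]
  simp only [mul_neg]

/-- Apply `young_rpow` to `|u|` with `D = n + 2a`, `P = p`. The error term is integrable against the
weight because `α > 1` and `p ≥ 1` make `2p/(α-1)` positive. -/
theorem integrableOn_weight_mul_of_power {p : ℕ} {a α τ : ℝ} (hp : 1 ≤ p) (ha : 1 ≤ a)
    (hα : 1 < α) (hτ : τ = (n + 2 * a + 2 * p) - α * (n + 2 * a - 2 * p))
    {u : EuclideanSpace ℝ (Fin (n + 1)) → ℝ} (hu : ContinuousOn u (puncturedBall n))
    (hpow : (∃ m : ℕ, α = m) ∨ ∀ x ∈ puncturedBall n, 0 ≤ u x)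
    (hint : IntegrableOn (fun x : EuclideanSpace ℝ (Fin (n + 1)) =>
      |x (Fin.last n)| ^ (2 * a - 1) * ‖x‖ ^ (-τ) * u x ^ α) (ball 0 1 \ {0})) :
    IntegrableOn (fun x : EuclideanSpace ℝ (Fin (n + 1)) =>
      |x (Fin.last n)| ^ (2 * a - 1) * (‖x‖ ^ (-(2 * p : ℝ)) * u x)) (ball 0 1 \ {0}) := by
  have hα1 : 0 < α - 1 := by linarith
  have hp0 : (0 : ℝ) < p := by exact_mod_cast hp
  have hm : MeasurableSet (ball (0 : EuclideanSpace ℝ (Fin (n + 1))) 1 \ {0}) :=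
    measurableSet_ball.diff (measurableSet_singleton _)
  have hsub : ball (0 : EuclideanSpace ℝ (Fin (n + 1))) 1 \ {0} ⊆ puncturedBall n :=
    fun x hx => ⟨ball_subset_closedBall hx.1, hx.2⟩
  have hI := integrableOn_weight_mul_norm_rpow (n := n) (a := a)
    (e := -(n + 2 * a) + 2 * p / (α - 1)) ha (by
      have : 0 < 2 * (p : ℝ) / (α - 1) := by positivity
      linarith)
  refine (hint.norm.add hI).mono' ?_ ?_
  · refine ContinuousOn.aestronglyMeasurable
      (s := ball (0 : EuclideanSpace ℝ (Fin (n + 1))) 1 \ {0}) ?_ hm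
    refine (continuous_abs_last_rpow (by linarith)).continuousOn.mul
      ((ContinuousOn.rpow_const continuous_norm.continuousOn fun x hx => Or.inl ?_).mul
        (hu.mono hsub))
    exact norm_ne_zero_iff.2 hx.2
  · refine (ae_restrict_iff' hm).2 (ae_of_all _ fun x hx => ?_)
    have hx0 : 0 < ‖x‖ := norm_pos_iff.2 hx.2
    have hρ : 0 ≤ |x (Fin.last n)| ^ (2 * a - 1) := by positivity
    have hy := young_rpow (D := n + 2 * a) (P := p) hx0 (abs_nonneg (u x)) hα
    rw [← hτ] at hy
    rw [← abs_rpow_eq_rpow_abs (hpow.imp_right fun h => h x (hsub hx))] at hy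
    simp only [Pi.add_apply, norm_mul, Real.norm_eq_abs, abs_of_nonneg hρ,
      abs_of_pos (Real.rpow_pos_of_pos hx0 _)]
    calc _ ≤ |x (Fin.last n)| ^ (2 * a - 1) * (‖x‖ ^ (-τ) * |u x ^ α| +
          ‖x‖ ^ (-(n + 2 * a) + 2 * p / (α - 1))) := mul_le_mul_of_nonneg_left hy hρ
      _ = _ := by ring

/-- Along a ray the weight is `r^{2a-1}` times its value on the sphere; its derivative at `r = 1`
produces the term `(2a-1) v_i` subtracted in the theorem. -/
theorem hasDerivWithinAt_weight_ray {a : ℝ} {f : EuclideanSpace ℝ (Fin (n + 1)) → ℝ}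
    (hf : DifferentiableOn ℝ f (puncturedBall n))
    (θ : sphere (0 : EuclideanSpace ℝ (Fin (n + 1))) 1) :
    HasDerivWithinAt (fun r : ℝ =>
      |(r • (θ : EuclideanSpace ℝ (Fin (n + 1)))) (Fin.last n)| ^ (2 * a - 1) *
        f (r • (θ : EuclideanSpace ℝ (Fin (n + 1)))))
      ((2 * a - 1) * (|(θ : EuclideanSpace ℝ (Fin (n + 1))) (Fin.last n)| ^ (2 * a - 1) * f θ) +
        |(θ : EuclideanSpace ℝ (Fin (n + 1))) (Fin.last n)| ^ (2 * a - 1) * radialField f θ)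
      (Ioc 0 1) 1 := by
  have h1 : HasDerivWithinAt (fun r : ℝ => r ^ (2 * a - 1)) (2 * a - 1) (Ioc 0 1) 1 := by
    simpa using (Real.hasDerivAt_rpow_const (x := 1) (p := 2 * a - 1)
      (Or.inl one_ne_zero)).hasDerivWithinAt (s := Ioc (0 : ℝ) 1)
  have h2 := hasDerivWithinAt_ray hf (right_mem_Ioc.2 one_pos) θ
  have h3 := (h1.mul_const
    (|(θ : EuclideanSpace ℝ (Fin (n + 1))) (Fin.last n)| ^ (2 * a - 1))).mul h2
  simp only [one_smul, Real.one_rpow, one_mul] at h3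
  refine (h3.congr (fun r hr => ?_) ?_).congr_deriv (by ring)
  · simp only [abs_last_rpow_smul hr.1.le, Pi.mul_apply]
  · simp

end Singularity

/-! ### The identity on the ball -/

theorem theorem1p3 (n p : ℕ) (hn : 1 ≤ n) (hp : 1 ≤ p) (a α τ : ℝ) (ha : 1 ≤ a) (hα : 1 < α)
    (hτ : τ = (n + 2 * a + 2 * p) - α * (n + 2 * a - 2 * p))
    (u : EuclideanSpace ℝ (Fin (n + 1)) → ℝ)
    (hreg : ContDiffOn ℝ ((2 * p : ℕ) : WithTop ℕ∞) u (puncturedBall n))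
    (heven : ∀ x ∈ puncturedBall n, u (reflectLast x) = u x)
    -- `u ^ α` has to be a genuine power
    (hpow : (∃ m : ℕ, α = m) ∨ ∀ x ∈ puncturedBall n, 0 ≤ u x)
    (heq : ∀ x ∈ ball (0 : EuclideanSpace ℝ (Fin (n + 1))) 1 \ {0},
      negLaplacianPow a (puncturedBall n) p u x = ‖x‖ ^ (-τ) * u x ^ α)
    (hint : IntegrableOn
      (fun x : EuclideanSpace ℝ (Fin (n + 1)) =>
        |x (Fin.last n)| ^ (2 * a - 1) * ‖x‖ ^ (-τ) * u x ^ α)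
      (ball 0 1) volume) :
    ∀ i < p,
      (∀ x ∈ sphere (0 : EuclideanSpace ℝ (Fin (n + 1))) 1,
        DifferentiableWithinAt ℝ (fun r : ℝ => weightedIterate a u i (r • x)) (Set.Ioc 0 1) 1) ∧
      Integrable
        (fun x : sphere (0 : EuclideanSpace ℝ (Fin (n + 1))) 1 =>
          radialDeriv (weightedIterate a u i) x - (2 * a - 1) * weightedIterate a u i x)
        (volume : Measure (EuclideanSpace ℝ (Fin (n + 1)))).toSphere ∧
      (∀ s : ℝ, 0 < s →
        IntegrableOn (weightedIterate a u (i + 1))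
          (ball (0 : EuclideanSpace ℝ (Fin (n + 1))) 1 \ ball 0 s) volume) ∧
      ∃ L : ℝ,
        Tendsto
          (fun s : ℝ => ∫ x in ball (0 : EuclideanSpace ℝ (Fin (n + 1))) 1 \ ball 0 s,
            weightedIterate a u (i + 1) x)
          (𝓝[>] 0) (𝓝 L) ∧
        (∫ x : sphere (0 : EuclideanSpace ℝ (Fin (n + 1))) 1,
          (radialDeriv (weightedIterate a u i) x - (2 * a - 1) * weightedIterate a u i x)
          ∂(volume : Measure (EuclideanSpace ℝ (Fin (n + 1)))).toSphere) + L = 0 := by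
  intro i hi
  have hN : (0 : ℝ) ≤ n + 2 * a - 1 := by
    have : (0 : ℝ) ≤ n := Nat.cast_nonneg n
    linarith
  set w : ℕ → EuclideanSpace ℝ (Fin (n + 1)) → ℝ :=
    fun j => negLaplacianPow a (puncturedBall n) j u with hw
  have hregw : ∀ j < p, ContDiffOn ℝ 2 (w j) (puncturedBall n) := fun j hj =>
    (negLaplacianPow_regular a hreg heven hj.le).1.of_le (by norm_cast; omega)
  have hregw1 : ∀ j < p, ContDiffOn ℝ 1 (w j) (puncturedBall n) := fun j hj =>
    (hregw j hj).of_le (by norm_cast)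
  have hevenw : ∀ j < p, ∀ x ∈ puncturedBall n, w j (reflectLast x) = w j x := fun j hj =>
    (negLaplacianPow_regular a hreg heven hj.le).2
  have hcontw : ∀ j ≤ p, ContinuousOn (w j) (puncturedBall n) := fun j hj =>
    (negLaplacianPow_regular a hreg heven hj).1.continuousOn
  have hflux : ∀ j < p, ∀ r ∈ Set.Ioo (0 : ℝ) 1,
      HasDerivAt (fun r : ℝ => r ^ (n + 2 * a - 1) * sphericalMean a (radialField (w j)) r)
        (-(r ^ (n + 2 * a - 1) * sphericalMean a (w (j + 1)) r)) r := by
    intro j hj r hr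
    have h := hasDerivAt_flux ha (hregw j hj) (hevenw j hj) hr
    have hneg : sphericalMean a (w (j + 1)) r =
        -sphericalMean a (weightedLaplacian a (puncturedBall n) (w j)) r :=
      sphericalMean_neg a _ r
    rw [hneg, mul_neg, neg_neg]
    exact h
  have hsub : ball (0 : EuclideanSpace ℝ (Fin (n + 1))) 1 \ {0} ⊆ ball 0 1 := Set.sdiff_subset
  have hintp : IntegrableOn (fun r : ℝ => r ^ (n + 2 * a - 1) * sphericalMean a (w p) r)
      (Set.Ioo 0 1) := by
    refine integrableOn_flux_of_integrableOn_weight ((hint.mono_set hsub).congr_fun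
      (fun x hx => ?_) (measurableSet_ball.diff (measurableSet_singleton _)))
    simp only [hw, heq x hx, mul_assoc]
  have hbase : IntegrableOn
      (fun r : ℝ => r ^ ((n + 2 * a - 1) - 2 * (p : ℝ)) * sphericalMean a (w 0) r)
      (Set.Ioo 0 1) := by
    refine (integrableOn_flux_of_integrableOn_weight (integrableOn_weight_mul_of_power hp ha hα hτ
      (hcontw 0 p.zero_le) hpow (hint.mono_set hsub))).congr_fun (fun r hr => ?_)
      measurableSet_Ioo
    simp only [sphericalMean_norm_rpow_mul a _ _ hr.1, sub_eq_add_neg _ (2 * (p : ℝ)),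
      Real.rpow_add hr.1 _ (-(2 * (p : ℝ))), mul_assoc]
  have hlim := tendsto_flux_zero hN
    (W := fun j => sphericalMean a (w j)) (W' := fun j => sphericalMean a (radialField (w j)))
    (fun j hj r hr => hasDerivAt_sphericalMean ha (hregw1 j hj) hr) hflux
    (fun j hj => (continuousOn_sphericalMean ha (hcontw j hj)).mono Set.Ioo_subset_Ioc_self)
    hintp hbase hi
  have hrad := continuousOn_radialField (hregw1 i hi)
  have hdiff : DifferentiableOn ℝ (w i) (puncturedBall n) :=
    (hregw1 i hi).differentiableOn (by simp)
  -- The term `(2a-1) v_i` cancels the derivative of the weight, leaving the integrand of the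
  -- spherical mean of `∂_r w_i` at radius `1`.
  have hsphere : ∀ x : sphere (0 : EuclideanSpace ℝ (Fin (n + 1))) 1,
      radialDeriv (weightedIterate a u i) x - (2 * a - 1) * weightedIterate a u i x =
        |(x : EuclideanSpace ℝ (Fin (n + 1))) (Fin.last n)| ^ (2 * a - 1) *
          radialField (w i) ((1 : ℝ) • (x : EuclideanSpace ℝ (Fin (n + 1)))) := by
    intro x
    have h := (hasDerivWithinAt_weight_ray (a := a) hdiff x).derivWithin
      (uniqueDiffOn_Ioc 0 1 1 (Set.right_mem_Ioc.2 one_pos))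
    have h' : radialDeriv (weightedIterate a u i) x = _ := h
    rw [h', one_smul]
    exact add_sub_cancel_left _ _
  simp only [hsphere]
  -- Fundamental theorem of calculus for the flux. Continuity up to `r = 1` suffices at the outer
  -- end, since the flux equation is only known on `(0,1)`.
  have hann : ∀ s ∈ Set.Ioo (0 : ℝ) 1,
      ∫ x in ball (0 : EuclideanSpace ℝ (Fin (n + 1))) 1 \ ball 0 s,
        weightedIterate a u (i + 1) x =
      s ^ (n + 2 * a - 1) * sphericalMean a (radialField (w i)) s -
        sphericalMean a (radialField (w i)) 1 := by
    intro s hs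
    have h1 : ∫ x in ball (0 : EuclideanSpace ℝ (Fin (n + 1))) 1 \ ball 0 s,
        weightedIterate a u (i + 1) x = _ := integral_weight_annulus ha (hcontw (i + 1) hi) hs
    have hIcc : Set.Icc s 1 ⊆ Set.Ioc 0 1 := fun r hr => ⟨hs.1.trans_le hr.1, hr.2⟩
    have h2 := intervalIntegral.integral_eq_sub_of_hasDerivAt_of_le hs.2.le
      ((continuousOn_flux ha hrad).mono hIcc)
      (fun r hr => hflux i hi r ⟨hs.1.trans hr.1, hr.2⟩)
      (ContinuousOn.intervalIntegrable (by
        rw [Set.uIcc_of_le hs.2.le]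
        exact ((continuousOn_flux ha (hcontw (i + 1) hi)).mono hIcc).neg))
    rw [intervalIntegral.integral_neg, Real.one_rpow, one_mul] at h2
    rw [h1]
    linarith
  refine ⟨fun x hx => ?_, ?_, fun s hs => ?_, -sphericalMean a (radialField (w i)) 1, ?_, ?_⟩
  · exact (hasDerivWithinAt_weight_ray (a := a) hdiff ⟨x, hx⟩).differentiableWithinAt
  · exact integrable_sphere_of_continuous
      (continuous_sphere_weight_mul ha hrad (Set.right_mem_Ioc.2 one_pos))
  · exact integrableOn_weight_annulus ha (hcontw (i + 1) hi) hs
  · have h := hlim.sub_const (sphericalMean a (radialField (w i)) 1)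
    rw [zero_sub] at h
    refine h.congr' ?_
    filter_upwards [Ioo_mem_nhdsGT (zero_lt_one (α := ℝ))] with s hs using (hann s hs).symm
  · exact add_neg_cancel _
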